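/- Let $p$ be a prime and $d\ge 1$. For a finitely supported family $a=(a_k)$ of constants in $\mathbb{Q}_p$, indexed by the multi-indices $k=(k_1,\dots,k_d)$ of non-negative integers, and random variables $Z_{i,k}$ ($1\le i\le d$, $k$ a multi-index) that are $\mathbb{Q}_p$-valued, independent and all distributed according to normalized Haar measure on $\mathbb{Z}_p$, consider the random system $$F_i(t_1,\dots,t_d)=\sum_k a_k Z_{i,k}\binom{t_1}{k_1}\cdots\binom{t_d}{k_d},\qquad 1\le i\le d,\quad t\in\mathbb{Z}_p^d,$$ where $\binom{t}{n}=t(t-1)\cdots(t-n+1)/n!$. Let $|\cdot|$ be the $p$-adic absolute value with $|p|=p^{-1}$, and let $e_j$ be the $j$-th unit multi-index. (1) Suppose that $a_0=1$, that $a_{e_j}\neq 0$ for $1\le j\le d$, and that $|a_k|\ge|a_\ell|$ whenever $k_j\le\ell_j$ for all $j$. Then for every $x\in\mathbb{Z}_p^d$ the number of points $t\in\mathbb{Z}_p^d$ with $F_i(t)=x_i$ for all $1\le i\le d$ is a random variable with values in $\{0,1,2,\dots\}\cup\{\infty\}$, and its expected value is $$\left[\prod_{j=1}^d\ \sup_{h\ge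 1}\left|\frac{a_{he_j}}{h}\right|\right]\left(1+p^{-1}+p^{-2}+\cdots+p^{-d}\right)^{-1}.$$ (2) In particular, let $N\ge 1$ and let $a_k=1$ if $k_j\le N$ for all $j$, and $a_k=0$ otherwise. Then for every $x\in\mathbb{Z}_p^d$ the expected number of such points is $$p^{d\lfloor\log_p N\rfloor}\left(1+p^{-1}+p^{-2}+\cdots+p^{-d}\right)^{-1}.$$ -/

import Mathlib

open MeasureTheory ProbabilityTheory
open scoped ENNReal

namespace PadicSystem

/-- `ℚ_p` carries its Borel σ-algebra. -/
noncomputable instance instMeasurableSpacePadic (p : ℕ) [Fact p.Prime] : MeasurableSpace ℚ_[p] := borel _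

instance instBorelSpacePadic (p : ℕ) [Fact p.Prime] : BorelSpace ℚ_[p] := ⟨rfl⟩

/-- The closed unit ball `{y : |y| ≤ 1}` of `ℚ_p`, that is `ℤ_p` as a subset of `ℚ_p`,
as a compact set with non-empty interior. -/
def unitBall (p : ℕ) [Fact p.Prime] : TopologicalSpace.PositiveCompacts ℚ_[p] where
  carrier := Metric.closedBall 0 1
  isCompact' := isCompact_closedBall 0 1
  interior_nonempty' :=
    ⟨0, Metric.ball_subset_interior_closedBall (Metric.mem_ball_self one_pos)⟩

/-- Haar measure on the additive group of `ℚ_p`, normalized to give `ℤ_p` mass `1`. -/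
noncomputable def padicHaar (p : ℕ) [Fact p.Prime] : Measure ℚ_[p] :=
  Measure.addHaarMeasure (unitBall p)

/-- The standard `ℚ_p`-Gaussian distribution: normalized Haar measure on `ℤ_p`, regarded as a
probability measure on `ℚ_p`. -/
noncomputable def padicGaussian (p : ℕ) [Fact p.Prime] : Measure ℚ_[p] :=
  (padicHaar p).restrict (Metric.closedBall 0 1)

/-- The value at `t ∈ ℤ_p^d` of the `i`-th function
`F_i(t) = ∑_k a_k z_{i,k} binom(t_1, k_1) ⋯ binom(t_d, k_d)`, the sum being over the (finitely
many) multi-indices `k` with `a_k ≠ 0`. -/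
noncomputable def F {p : ℕ} [Fact p.Prime] {d : ℕ} (a : (Fin d → ℕ) →₀ ℚ_[p])
    (z : Fin d → (Fin d → ℕ) → ℚ_[p]) (i : Fin d) (t : Fin d → ℤ_[p]) : ℚ_[p] :=
  a.sum fun k c => c * z i k * ∏ j, ((Ring.choose (t j) (k j) : ℤ_[p]) : ℚ_[p])

/-- The number (possibly infinite) of solutions `t ∈ ℤ_p^d` of `F_i(t) = x_i`, `1 ≤ i ≤ d`. -/
noncomputable def numSolutions {p : ℕ} [Fact p.Prime] {d : ℕ} (a : (Fin d → ℕ) →₀ ℚ_[p])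
    (z : Fin d → (Fin d → ℕ) → ℚ_[p]) (x : Fin d → ℤ_[p]) : ℝ≥0∞ :=
  (Set.encard {t : Fin d → ℤ_[p] | ∀ i, F a z i t = (x i : ℚ_[p])} : ℕ∞)

/-- The coefficients of the simplest model of degree `N` in each variable: `a_k = 1` if
`k_j ≤ N` for all `j`, and `a_k = 0` otherwise. -/
noncomputable def simplestModel (p : ℕ) [Fact p.Prime] (d N : ℕ) : (Fin d → ℕ) →₀ ℚ_[p] :=
  Finsupp.indicator (Finset.Iic fun _ => N) fun _ _ => 1

end PadicSystem

namespace PadicSystem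

section Haar

variable (p : ℕ) [Fact p.Prime]

noncomputable instance instMeasurableSpacePadicInt : MeasurableSpace ℤ_[p] := borel _

instance instBorelSpacePadicInt : BorelSpace ℤ_[p] := ⟨rfl⟩

/-- `ℤ_p` carries its Haar probability measure. -/
noncomputable instance instMeasureSpacePadicInt : MeasureSpace ℤ_[p] :=
  ⟨Measure.addHaarMeasure ⊤⟩

instance instIsAddHaarMeasurePadicInt : (volume : Measure ℤ_[p]).IsAddHaarMeasure :=
  inferInstanceAs (Measure.addHaarMeasure (⊤ : TopologicalSpace.PositiveCompacts ℤ_[p])).IsAddHaarMeasure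

instance instIsProbabilityMeasurePadicInt : IsProbabilityMeasure (volume : Measure ℤ_[p]) :=
  ⟨Measure.addHaarMeasure_self⟩

instance instNullSingletonClassPadicInt : NullSingletonClass (volume : Measure ℤ_[p]) := by
  have : (nhdsWithin (0 : ℤ_[p]) {0}ᶜ).NeBot := by
    rw [← mem_closure_iff_nhdsWithin_neBot, Metric.mem_closure_iff]
    intro ε hε
    obtain ⟨n, hn⟩ := PadicInt.exists_pow_neg_lt p hε
    refine ⟨(p : ℤ_[p]) ^ n, ?_, ?_⟩
    · simpa using fun h => (NeZero.ne p h).elim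
    · rwa [dist_comm, dist_zero_right, PadicInt.norm_p_pow]
  exact Measure.IsAddHaarMeasure.nullSingletonClass _

/-- A continuous surjective homomorphism between compact groups preserves the Haar probability
measures. -/
theorem measurePreserving_of_surjective {G H : Type*}
    [AddCommGroup G] [TopologicalSpace G] [IsTopologicalAddGroup G] [MeasureSpace G] [BorelSpace G]
    [(volume : Measure G).IsAddHaarMeasure] [IsProbabilityMeasure (volume : Measure G)]
    [AddCommGroup H] [TopologicalSpace H] [IsTopologicalAddGroup H] [MeasureSpace H] [BorelSpace H]
    [LocallyCompactSpace H]
    [(volume : Measure H).IsAddHaarMeasure] [IsProbabilityMeasure (volume : Measure H)]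
    (φ : G →+ H) (hφ : Continuous φ) (hs : Function.Surjective φ) :
    MeasurePreserving φ := by
  refine ⟨hφ.measurable, ?_⟩
  have := Measure.isAddHaarMeasure_map_of_isFiniteMeasure volume φ hφ hs
  have : IsProbabilityMeasure (Measure.map φ volume) :=
    Measure.isProbabilityMeasure_map hφ.measurable.aemeasurable
  exact Measure.isAddHaarMeasure_eq_of_isProbabilityMeasure _ _

end Haar

section Residue

variable {p : ℕ} [Fact p.Prime] {d : ℕ}

/-- Coordinatewise multiplication by the powers `p ^ α j`. -/
noncomputable def pScale (α : Fin d → ℕ) (v : Fin d → ℤ_[p]) : Fin d → ℤ_[p] := fun j => (p : ℤ_[p]) ^ α j * v j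

/-- Coordinatewise reduction modulo the powers `p ^ α j`. -/
noncomputable def residue (α : Fin d → ℕ) (v : Fin d → ℤ_[p]) : ∀ j, ZMod (p ^ α j) :=
  fun j => PadicInt.toZModPow (α j) (v j)

theorem residue_surjective (α : Fin d → ℕ) :
    Function.Surjective (residue (p := p) α) := by
  intro r
  choose v hv using fun j => ZMod.ringHom_surjective (PadicInt.toZModPow (p := p) (α j)) (r j)
  exact ⟨v, funext hv⟩

theorem residue_eq_iff {α : Fin d → ℕ} {s t : Fin d → ℤ_[p]} :
    residue α s = residue α t ↔ ∃ v, s = t + pScale α v := by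
  have key : ∀ j, PadicInt.toZModPow (α j) (s j) = PadicInt.toZModPow (α j) (t j) ↔
      (p : ℤ_[p]) ^ α j ∣ s j - t j := fun j => by
    rw [← sub_eq_zero, ← map_sub, ← RingHom.mem_ker, PadicInt.ker_toZModPow,
      Ideal.mem_span_singleton]
  constructor
  · intro h
    choose v hv using fun j => (key j).1 (congrFun h j)
    exact ⟨v, funext fun j => by simp [pScale, ← hv]⟩
  · rintro ⟨v, rfl⟩
    exact funext fun j => (key j).2 ⟨v j, by simp [pScale]⟩

theorem card_residue (α : Fin d → ℕ) :
    Fintype.card (∀ j, ZMod (p ^ α j)) = p ^ ∑ j, α j := by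
  simp [ZMod.card, Finset.prod_pow_eq_pow_sum]

theorem isClosed_residue_fiber (α : Fin d → ℕ) (r : ∀ j, ZMod (p ^ α j)) :
    IsClosed {v : Fin d → ℤ_[p] | residue α v = r} := by
  obtain ⟨t, rfl⟩ := residue_surjective (p := p) α r
  have : {v : Fin d → ℤ_[p] | residue α v = residue α t} = Set.range fun v => t + pScale α v := by
    ext v; simp only [Set.mem_ofPred_eq, residue_eq_iff, Set.mem_range, eq_comm (a := v)]
  rw [this]
  refine (isCompact_range ?_).isClosed
  unfold pScale
  fun_prop

end Residue

section Lattice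

variable (p : ℕ) [Fact p.Prime] (d : ℕ)

/-- A vector together with a square matrix over `ℤ_p`. -/
abbrev VecMat : Type := (Fin d → ℤ_[p]) × (Fin d → Fin d → ℤ_[p])

noncomputable instance : MeasureSpace (VecMat p d) := Measure.prod.measureSpace

instance (κ : Type*) [Fintype κ] : (volume : Measure (κ → Fin d → ℤ_[p])).IsAddHaarMeasure :=
  Measure.pi.isAddHaarMeasure fun _ => (volume : Measure (Fin d → ℤ_[p]))

instance : (volume : Measure (VecMat p d)).IsAddHaarMeasure :=
  Measure.prod.instIsAddHaarMeasure (volume : Measure (Fin d → ℤ_[p]))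
    (volume : Measure (Fin d → Fin d → ℤ_[p]))

variable {p d}

theorem volume_det_eq_zero :
    volume {U : Fin d → Fin d → ℤ_[p] | (Matrix.of U).det = 0} = 0 := by
  let φ : (Fin d → Fin d → ℤ_[p]) × ℤ_[p] →+ (Fin d → Fin d → ℤ_[p]) :=
    { toFun := fun x i j => Matrix.scalar (Fin d) x.2 i j - x.1 i j
      map_zero' := by ext; simp
      map_add' := fun x y => by ext i j; simp [Matrix.diagonal_apply]; split_ifs <;> ring }
  have hc : Continuous φ := by
    refine continuous_pi fun i => continuous_pi fun j => ?_
    simp only [φ, AddMonoidHom.coe_mk, ZeroHom.coe_mk, Matrix.scalar_apply, Matrix.diagonal_apply]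
    split_ifs <;> fun_prop
  have hs : Function.Surjective φ := fun U => ⟨(-U, 0), by ext; simp [φ]⟩
  have : ((volume : Measure (Fin d → Fin d → ℤ_[p])).prod (volume : Measure ℤ_[p])).IsAddHaarMeasure :=
    Measure.prod.instIsAddHaarMeasure _ _
  have : (volume : Measure ((Fin d → Fin d → ℤ_[p]) × ℤ_[p])).IsAddHaarMeasure := this
  have hφ := measurePreserving_of_surjective φ hc hs
  have hclosed : IsClosed {U : Fin d → Fin d → ℤ_[p] | (Matrix.of U).det = 0} :=
    isClosed_eq (Continuous.matrix_det (by fun_prop)) continuous_const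
  rw [← hφ.measure_preimage hclosed.measurableSet.nullMeasurableSet, Measure.volume_eq_prod,
    Measure.measure_prod_null (hφ.measurable hclosed.measurableSet)]
  refine Filter.Eventually.of_forall fun A => ?_
  refine Set.Finite.measure_zero ?_ _
  classical
  refine ((Matrix.of A).charpoly.roots.toFinset.finite_toSet).subset fun t ht => ?_
  classical
  have ht' : (Matrix.scalar (Fin d) t - Matrix.of A).det = 0 := ht
  simpa [(Matrix.charpoly_monic _).ne_zero, Matrix.eval_charpoly] using ht'
end Lattice

theorem isClosed_exists_of_compact {X Y : Type*} [TopologicalSpace X] [TopologicalSpace Y]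
    [CompactSpace Y] {C : Set (X × Y)} (hC : IsClosed C) : IsClosed {x | ∃ y, (x, y) ∈ C} := by
  have : {x | ∃ y, (x, y) ∈ C} = Prod.fst '' C := by ext; simp
  rw [this]
  exact isClosedMap_fst_of_compactSpace _ hC

section Lattice

variable {p : ℕ} [Fact p.Prime] {d : ℕ}

@[simp]
theorem pScale_zero_left (v : Fin d → ℤ_[p]) : pScale 0 v = v := by
  ext; simp [pScale]

theorem continuous_pScale (α : Fin d → ℕ) : Continuous (pScale (p := p) α) := by
  unfold pScale
  fun_prop

/-- The pairs `(y, U)` such that `y` belongs to the lattice generated by the columns of `U`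
multiplied by the powers `p ^ α j`. -/
def lat (α : Fin d → ℕ) : Set (VecMat p d) :=
  {x | ∃ v, x.1 = (Matrix.of x.2).mulVec (pScale α v)}

theorem isClosed_lat (α : Fin d → ℕ) : IsClosed (lat (p := p) α) := by
  refine isClosed_exists_of_compact
    (C := {z : VecMat p d × (Fin d → ℤ_[p]) | z.1.1 = (Matrix.of z.1.2).mulVec (pScale α z.2)}) ?_
  refine isClosed_eq (by fun_prop) (Continuous.matrix_mulVec (by fun_prop) ?_)
  exact (continuous_pScale α).comp continuous_snd

theorem measurePreserving_matrix :
    MeasurePreserving (Prod.snd : VecMat p d → Fin d → Fin d → ℤ_[p]) :=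
  measurePreserving_of_surjective
    (AddMonoidHom.snd (Fin d → ℤ_[p]) (Fin d → Fin d → ℤ_[p])) continuous_snd Prod.snd_surjective

theorem volume_singular :
    volume {x : VecMat p d | (Matrix.of x.2).det = 0} = 0 :=
  measurePreserving_matrix.quasiMeasurePreserving.preimage_null volume_det_eq_zero

/-- The shear `(y, U) ↦ (y - U t, U)`. -/
noncomputable def shear (t : Fin d → ℤ_[p]) : VecMat p d →+ VecMat p d where
  toFun x := (x.1 - (Matrix.of x.2).mulVec t, x.2)
  map_zero' := by
    ext i
    · simp
    · simp
  map_add' x y := by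
    ext i
    · simp [Matrix.mulVec, dotProduct, add_mul, Finset.sum_add_distrib]; ring
    · simp

theorem measurePreserving_shear (t : Fin d → ℤ_[p]) : MeasurePreserving (shear t) := by
  refine measurePreserving_of_surjective _ ?_ fun x => ⟨(x.1 + (Matrix.of x.2).mulVec t, x.2), ?_⟩
  · exact (continuous_fst.sub (Continuous.matrix_mulVec (by fun_prop) continuous_const)).prodMk
      continuous_snd
  · simp [shear]

theorem volume_lat (α : Fin d → ℕ) :
    (p : ℝ≥0∞) ^ (∑ j, α j) * volume (lat (p := p) α) = volume (lat (p := p) (0 : Fin d → ℕ)) := by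
  let A : (∀ j, ZMod (p ^ α j)) → Set (VecMat p d) := fun r =>
    {x | ∃ v, residue α v = r ∧ x.1 = (Matrix.of x.2).mulVec v}
  have hpre : ∀ t, A (residue α t) = shear t ⁻¹' lat α := by
    intro t
    ext x
    simp only [A, lat, Set.mem_ofPred_eq, Set.mem_preimage, residue_eq_iff, shear,
      AddMonoidHom.coe_mk, ZeroHom.coe_mk]
    constructor
    · rintro ⟨_, ⟨v, rfl⟩, h⟩
      exact ⟨v, by rw [h, Matrix.mulVec_add]; simp⟩
    · rintro ⟨v, h⟩
      exact ⟨_, ⟨v, rfl⟩, by rw [Matrix.mulVec_add, ← h]; simp⟩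
  have hmeas : ∀ r, NullMeasurableSet (A r) ∧ volume (A r) = volume (lat (p := p) α) := by
    intro r
    obtain ⟨t, rfl⟩ := residue_surjective (p := p) α r
    have hl := (isClosed_lat (p := p) α).measurableSet
    rw [hpre]
    exact ⟨((measurePreserving_shear t).measurable hl).nullMeasurableSet,
      (measurePreserving_shear t).measure_preimage hl.nullMeasurableSet⟩
  have hU : lat (p := p) (0 : Fin d → ℕ) = ⋃ r, A r := by
    ext x
    simp [lat, A]
  have hdisj : Pairwise (Function.onFun (AEDisjoint volume) A) := by
    intro r r' hr
    refine measure_mono_null ?_ (volume_singular (p := p) (d := d))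
    rintro x ⟨⟨v, hv, h⟩, ⟨v', hv', h'⟩⟩
    by_contra hdet
    refine hr ?_
    rw [← hv, ← hv', sub_eq_zero.1 (Matrix.eq_zero_of_mulVec_eq_zero hdet (v := v - v') ?_)]
    rw [Matrix.mulVec_sub, ← h, ← h', sub_self]
  rw [hU, measure_iUnion₀ hdisj fun r => (hmeas r).1, tsum_fintype]
  simp only [(hmeas _).2, Finset.sum_const, Finset.card_univ, card_residue, nsmul_eq_mul]
  push_cast
  rfl

theorem volume_residue_fiber (α : Fin d → ℕ) :
    (p : ℝ≥0∞) ^ (∑ j, α j) * volume {v : Fin d → ℤ_[p] | residue α v = 0} = 1 := by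
  let A : (∀ j, ZMod (p ^ α j)) → Set (Fin d → ℤ_[p]) := fun r => {v | residue α v = r}
  have hmeas : ∀ r, volume (A r) = volume (A 0) := by
    intro r
    obtain ⟨t, rfl⟩ := residue_surjective (p := p) α r
    rw [← measure_preimage_add volume t (A (residue α t))]
    congr 1
    ext v
    have : residue α (t + v) = residue α t + residue α v := by ext; simp [residue]
    simp [A, this]
  have hdisj : Pairwise (Function.onFun Disjoint A) := by
    intro r r' hr
    exact Set.disjoint_left.2 fun v hv hv' => hr (hv.symm.trans hv')
  have hU : (Set.univ : Set (Fin d → ℤ_[p])) = ⋃ r, A r := by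
    ext x
    simp [A]
  have h1 := measure_univ (μ := (volume : Measure (Fin d → ℤ_[p])))
  rw [hU, measure_iUnion hdisj fun r => (isClosed_residue_fiber α r).measurableSet, tsum_fintype] at h1
  simp only [hmeas, Finset.sum_const, Finset.card_univ, card_residue, nsmul_eq_mul] at h1
  rw [← h1]
  push_cast
  rfl

theorem exists_padicInt_eq {x : ℚ_[p]} (h : ‖x‖ ≤ 1) : ∃ c : ℤ_[p], (c : ℚ_[p]) = x :=
  ⟨⟨x, h⟩, rfl⟩

theorem dvd_of_norm_le {a b : ℤ_[p]} (h : ‖a‖ ≤ ‖b‖) : b ∣ a := by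
  rcases eq_or_ne b 0 with rfl | hb
  · rw [norm_zero, norm_le_zero_iff] at h
    rw [h]
  · have hb' : (b : ℚ_[p]) ≠ 0 := by simpa using hb
    obtain ⟨c, hc⟩ := exists_padicInt_eq (x := (a / b : ℚ_[p])) (by
      rw [norm_div]
      exact div_le_one_of_le₀ (by simpa using h) (norm_nonneg _))
    refine ⟨c, PadicInt.ext ?_⟩
    rw [PadicInt.coe_mul, hc, mul_div_cancel₀ _ hb']

/-- Splitting off the `j`-th of `d + 1` column vectors. -/
noncomputable def splitColumn (j : Fin (d + 1)) :
    (Fin (d + 1) → Fin d → ℤ_[p]) →+ VecMat p d where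
  toFun X := (X j, fun a b => X (j.succAbove b) a)
  map_zero' := rfl
  map_add' _ _ := rfl

theorem measurePreserving_splitColumn (j : Fin (d + 1)) :
    MeasurePreserving (splitColumn (p := p) j) := by
  refine measurePreserving_of_surjective _ ?_ fun x => ⟨j.insertNth x.1 fun b a => x.2 a b, ?_⟩
  · change Continuous fun X : Fin (d + 1) → Fin d → ℤ_[p] => (X j, fun a b => X (j.succAbove b) a)
    fun_prop
  · simp [splitColumn]

theorem exists_kernel_vector (X : Fin (d + 1) → Fin d → ℤ_[p]) :
    ∃ j, ∃ w : Fin (d + 1) → ℤ_[p], w j = 1 ∧ (∀ i, j < i → (p : ℤ_[p]) ∣ w i) ∧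
      ∑ i, w i • X i = 0 := by
  obtain ⟨w, hw, hw0⟩ : ∃ w : Fin (d + 1) → ℤ_[p], ∑ i, w i • X i = 0 ∧ w ≠ 0 := by
    by_contra! h
    have := le_of_fin_injective ℤ_[p] (Fintype.linearCombination ℤ_[p] X)
      ((injective_iff_map_eq_zero _).2 fun w hw => h w (by
        simpa [Fintype.linearCombination_apply] using hw))
    omega
  obtain ⟨j, hj, hmax⟩ : ∃ j, (∀ i, ‖w i‖ ≤ ‖w j‖) ∧ ∀ i, j < i → ‖w i‖ < ‖w j‖ := by
    obtain ⟨j₀, hj₀⟩ := Finite.exists_max fun i => ‖w i‖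
    let S := Finset.univ.filter fun i => ‖w j₀‖ ≤ ‖w i‖
    have hS : S.Nonempty := ⟨j₀, by simp [S]⟩
    have hm := S.max'_mem hS
    simp only [S, Finset.mem_filter, Finset.mem_univ, true_and] at hm
    refine ⟨S.max' hS, fun i => (hj₀ i).trans hm, fun i hi => ?_⟩
    by_contra! hle
    exact absurd (S.le_max' i (by simpa [S] using hm.trans hle)) (not_le.2 hi)
  have hwj : w j ≠ 0 := fun h0 => hw0 <| funext fun i => by
    simpa [h0] using hj i
  choose u hu using fun i => dvd_of_norm_le (hj i)
  refine ⟨j, u, ?_, fun i hi => ?_, ?_⟩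
  · exact mul_left_cancel₀ hwj (by rw [← hu, mul_one])
  · rw [← PadicInt.norm_lt_one_iff_dvd]
    have h := hmax i hi
    rw [hu i, norm_mul] at h
    exact lt_of_mul_lt_mul_left (by simpa using h) (norm_nonneg (w j))
  · have : w j • ∑ i, u i • X i = 0 := by
      rw [Finset.smul_sum, ← hw]
      exact Finset.sum_congr rfl fun i _ => by rw [smul_smul, ← hu]
    exact (smul_eq_zero.1 this).resolve_left hwj

/-- The probability that a random vector of `ℤ_p^d` lies in the lattice generated by `d` other
independent ones. -/
theorem volume_lat_zero :
    volume (lat (p := p) (0 : Fin d → ℕ)) =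
      (∑ i ∈ Finset.range (d + 1), (p : ℝ≥0∞)⁻¹ ^ i)⁻¹ := by
  let J : Fin (d + 1) → Set (Fin (d + 1) → Fin d → ℤ_[p]) := fun j =>
    {X | ∃ w : Fin (d + 1) → ℤ_[p], w j = 1 ∧ (∀ i, j < i → (p : ℤ_[p]) ∣ w i) ∧
      ∑ i, w i • X i = 0}
  let α : Fin (d + 1) → Fin d → ℕ := fun j b => if j < j.succAbove b then 1 else 0
  have hpre : ∀ j, J j = splitColumn j ⁻¹' lat (α j) := by
    intro j
    ext X
    simp only [J, lat, Set.mem_ofPred_eq, Set.mem_preimage, splitColumn, AddMonoidHom.coe_mk,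
      ZeroHom.coe_mk]
    constructor
    · rintro ⟨w, hj, hdvd, hw⟩
      have : ∀ b, ∃ u, -w (j.succAbove b) = (p : ℤ_[p]) ^ α j b * u := by
        intro b
        by_cases hb : j < j.succAbove b
        · obtain ⟨u, hu⟩ := hdvd _ hb
          exact ⟨-u, by simp [α, hb, hu]⟩
        · exact ⟨-w (j.succAbove b), by simp [α, hb]⟩
      choose u hu using this
      refine ⟨u, ?_⟩
      rw [Fin.sum_univ_succAbove _ j, hj, one_smul] at hw
      ext a
      have ha := congrFun hw a
      simp only [Pi.add_apply, Finset.sum_apply, Pi.smul_apply, smul_eq_mul, Pi.zero_apply] at ha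
      simp only [Matrix.mulVec, dotProduct, Matrix.of_apply, pScale, ← hu]
      rw [eq_neg_of_add_eq_zero_left ha, ← Finset.sum_neg_distrib]
      exact Finset.sum_congr rfl fun b _ => by ring
    · rintro ⟨u, hu⟩
      refine ⟨j.insertNth 1 fun b => -pScale (α j) u b, by simp, fun i hi => ?_, ?_⟩
      · obtain ⟨b, rfl⟩ := Fin.exists_succAbove_eq hi.ne'
        simp [pScale, α, hi]
      · rw [Fin.sum_univ_succAbove _ j]
        ext a
        have ha := congrFun hu a
        simp only [Matrix.mulVec, dotProduct, Matrix.of_apply] at ha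
        simp [ha, mul_comm]
  have hvol : ∀ j, volume (J j) = volume (lat (p := p) (α j)) := fun j => by
    rw [hpre]
    exact (measurePreserving_splitColumn j).measure_preimage
      (isClosed_lat _).measurableSet.nullMeasurableSet
  have hdisj' : ∀ j j', j < j' → AEDisjoint volume (J j) (J j') := by
    intro j j' hlt
    refine measure_mono_null ?_
      ((measurePreserving_splitColumn j).quasiMeasurePreserving.preimage_null
        (volume_singular (p := p) (d := d)))
    rintro X ⟨⟨w, hj, hdvd, hw⟩, ⟨w', hj', -, hw'⟩⟩
    have hsum : ∑ i, (w' i - w' j * w i) • X i = 0 := by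
      simp only [sub_smul, mul_smul, Finset.sum_sub_distrib, ← Finset.smul_sum, hw, hw']
      simp
    rw [Fin.sum_univ_succAbove _ j, hj] at hsum
    refine Matrix.exists_mulVec_eq_zero_iff.1
      ⟨fun b => w' (j.succAbove b) - w' j * w (j.succAbove b), fun h0 => ?_, ?_⟩
    · obtain ⟨b, rfl⟩ := Fin.exists_succAbove_eq hlt.ne'
      have hb := congrFun h0 b
      simp only [hj', Pi.zero_apply] at hb
      have hone : (p : ℤ_[p]) ∣ 1 := by
        rw [sub_eq_zero.1 hb]
        exact (hdvd _ hlt).mul_left _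
      exact PadicInt.prime_p.not_isUnit (isUnit_of_dvd_one hone)
    · ext a
      have ha := congrFun hsum a
      simpa [Matrix.mulVec, dotProduct, splitColumn, mul_comm] using ha
  have hdisj : Pairwise (Function.onFun (AEDisjoint volume) J) := by
    intro j j' hne
    rcases lt_or_gt_of_ne hne with h | h
    · exact hdisj' _ _ h
    · exact (hdisj' _ _ h).symm
  have hcover : (Set.univ : Set (Fin (d + 1) → Fin d → ℤ_[p])) = ⋃ j, J j := by
    ext X
    simpa [J] using exists_kernel_vector X
  have hα : ∀ j : Fin (d + 1), ∑ b, α j b = d - j := by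
    intro j
    simp only [α, Fin.lt_succAbove_iff_le_castSucc, Fin.le_def, Fin.val_castSucc]
    rw [Fin.sum_univ_eq_sum_range (fun b => if (j : ℕ) ≤ b then 1 else 0) d, Finset.sum_boole]
    have : (Finset.range d).filter (fun b => (j : ℕ) ≤ b) = Finset.Ico (j : ℕ) d := by
      ext b; simp; omega
    simp [this]
  have hp0 : (p : ℝ≥0∞) ≠ 0 := by simpa using (Fact.out : p.Prime).ne_zero
  have hlat : ∀ j : Fin (d + 1), volume (lat (p := p) (α j)) =
      volume (lat (p := p) (0 : Fin d → ℕ)) * (p : ℝ≥0∞)⁻¹ ^ (d - j : ℕ) := by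
    intro j
    rw [← volume_lat (α j), hα, mul_right_comm, ← mul_pow,
      ENNReal.mul_inv_cancel hp0 (ENNReal.natCast_ne_top p), one_pow, one_mul]
  have h1 := measure_univ (μ := (volume : Measure (Fin (d + 1) → Fin d → ℤ_[p])))
  rw [hcover, measure_iUnion₀ hdisj, tsum_fintype] at h1
  · simp only [hvol, hlat, ← Finset.mul_sum] at h1
    rw [Fin.sum_univ_eq_sum_range (fun j => (p : ℝ≥0∞)⁻¹ ^ (d - j)) (d + 1)] at h1
    have hr := Finset.sum_range_reflect (fun j => (p : ℝ≥0∞)⁻¹ ^ j) (d + 1)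
    simp only [Nat.add_sub_cancel] at hr
    rw [hr] at h1
    exact ENNReal.eq_inv_of_mul_eq_one_left h1
  · intro j
    rw [hpre]
    exact ((measurePreserving_splitColumn j).measurable
      (isClosed_lat _).measurableSet).nullMeasurableSet

end Lattice

section Counting

variable {p : ℕ} [Fact p.Prime] {d : ℕ}

theorem residue_comp_of_le {α β : Fin d → ℕ} (h : α ≤ β) {s t : Fin d → ℤ_[p]}
    (hst : residue β s = residue β t) : residue α s = residue α t := by
  obtain ⟨v, hv⟩ := residue_eq_iff.1 hst
  refine residue_eq_iff.2 ⟨pScale (β - α) v, ?_⟩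
  rw [hv]
  congr 1
  ext j
  simp only [pScale, Pi.sub_apply, ← mul_assoc, ← pow_add]
  rw [Nat.add_sub_cancel' (h j)]

theorem encard_residue_image_mono {α β : Fin d → ℕ} (h : α ≤ β) (S : Set (Fin d → ℤ_[p])) :
    (residue α '' S).encard ≤ (residue β '' S).encard := by
  have : residue α '' S =
      (fun r => residue α (Function.surjInv (residue_surjective (p := p) β) r)) ''
        (residue β '' S) := by
    rw [Set.image_image]
    refine Set.image_congr fun s _ => residue_comp_of_le h ?_
    exact (Function.surjInv_eq (residue_surjective (p := p) β) (residue β s)).symm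
  rw [this]
  exact Set.encard_image_le _ _

theorem eventually_residue_injOn (w : Fin d → ℕ) {T : Set (Fin d → ℤ_[p])} (hT : T.Finite) :
    ∀ᶠ n : ℕ in Filter.atTop, Set.InjOn (residue (p := p) fun j => n + w j) T := by
  have hpair : ∀ s ∈ T, ∀ t ∈ T, ∀ᶠ n : ℕ in Filter.atTop,
      residue (p := p) (fun j => n + w j) s = residue (fun j => n + w j) t → s = t := by
    intro s _ t _
    rcases eq_or_ne s t with rfl | hst
    · simp
    obtain ⟨j, hj⟩ := Function.ne_iff.1 hst
    obtain ⟨n₀, hn₀⟩ := PadicInt.exists_pow_neg_lt p (norm_pos_iff.2 (sub_ne_zero.2 hj))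
    filter_upwards [Filter.eventually_ge_atTop n₀] with n hn heq
    obtain ⟨v, hv⟩ := residue_eq_iff.1 heq
    have h1 : s j - t j ∈ Ideal.span {(p : ℤ_[p]) ^ n₀} := by
      rw [Ideal.mem_span_singleton, hv]
      simp only [pScale, Pi.add_apply, add_sub_cancel_left]
      exact (pow_dvd_pow _ (by omega)).mul_right _
    rw [← PadicInt.norm_le_pow_iff_mem_span_pow] at h1
    exact absurd h1 (not_le.2 hn₀)
  have := (Filter.eventually_all_finite hT).2 fun s hs =>
    (Filter.eventually_all_finite hT).2 fun t ht => hpair s hs t ht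
  filter_upwards [this] with n hn s hs t ht h using hn s hs t ht h

theorem iSup_encard_residue_image (w : Fin d → ℕ) (S : Set (Fin d → ℤ_[p])) :
    ⨆ n : ℕ, (((residue (fun j => n + w j) '' S).encard : ℕ∞) : ℝ≥0∞) = (S.encard : ℕ∞) := by
  refine le_antisymm (iSup_le fun n => ?_) ?_
  · exact_mod_cast Set.encard_image_le _ _
  · have hfin : ∀ T ⊆ S, T.Finite → ((T.encard : ℕ∞) : ℝ≥0∞) ≤
        ⨆ n : ℕ, (((residue (fun j => n + w j) '' S).encard : ℕ∞) : ℝ≥0∞) := by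
      intro T hTS hT
      obtain ⟨n, hn⟩ := (eventually_residue_injOn w hT).exists
      refine le_iSup_of_le n ?_
      rw [← hn.encard_image]
      exact_mod_cast Set.encard_le_encard (Set.image_mono hTS)
    rcases S.finite_or_infinite with hS | hS
    · exact hfin S subset_rfl hS
    · rw [hS.encard_eq, ENat.toENNReal_top, top_le_iff]
      refine ENNReal.eq_top_of_forall_nnreal_le fun r => ?_
      obtain ⟨k, hk⟩ := exists_nat_ge r
      obtain ⟨T, hTS, hT⟩ := hS.exists_subset_card_eq k
      refine le_trans ?_ (hfin T hTS T.finite_toSet)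
      rw [Set.encard_coe_eq_coe_finsetCard, hT]
      calc (r : ℝ≥0∞) ≤ ((k : NNReal) : ℝ≥0∞) := ENNReal.coe_le_coe.2 hk
        _ = _ := by simp

theorem encard_eq_sum_indicator {R : Type*} [Fintype R] (A : Set R) :
    ((A.encard : ℕ∞) : ℝ≥0∞) = ∑ r, A.indicator 1 r := by
  classical
  rw [Set.encard_eq_coe_toFinset_card]
  simp [Set.indicator_apply, Finset.sum_boole, Set.toFinset_card, Fintype.card_subtype]

variable {Θ : Type*}

/-- The parameters for which the fibre of `C` meets the residue class `r`. -/
def hits (C : Set (Θ × (Fin d → ℤ_[p]))) (α : Fin d → ℕ) (r : ∀ j, ZMod (p ^ α j)) : Set Θ :=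
  {θ | ∃ t, residue α t = r ∧ (θ, t) ∈ C}

theorem isClosed_hits [TopologicalSpace Θ] {C : Set (Θ × (Fin d → ℤ_[p]))} (hC : IsClosed C) (α : Fin d → ℕ)
    (r : ∀ j, ZMod (p ^ α j)) : IsClosed (hits C α r) :=
  isClosed_exists_of_compact
    (C := {z : Θ × (Fin d → ℤ_[p]) | residue α z.2 = r ∧ z ∈ C})
    (((isClosed_residue_fiber α r).preimage continuous_snd).inter hC)

theorem encard_residue_image_eq (C : Set (Θ × (Fin d → ℤ_[p]))) (α : Fin d → ℕ) (θ : Θ) :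
    (((residue α '' {t | (θ, t) ∈ C}).encard : ℕ∞) : ℝ≥0∞) =
      ∑ r, (hits C α r).indicator 1 θ := by
  rw [encard_eq_sum_indicator]
  refine Finset.sum_congr rfl fun r _ => ?_
  have : r ∈ residue α '' {t | (θ, t) ∈ C} ↔ θ ∈ hits C α r := by
    simp [hits, and_comm]
  by_cases h : θ ∈ hits C α r
  · rw [Set.indicator_of_mem h, Set.indicator_of_mem (this.2 h)]; rfl
  · rw [Set.indicator_of_notMem h, Set.indicator_of_notMem (mt this.1 h)]

variable [TopologicalSpace Θ] [MeasurableSpace Θ] [OpensMeasurableSpace Θ]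

theorem measurable_encard_residue_image {C : Set (Θ × (Fin d → ℤ_[p]))} (hC : IsClosed C)
    (α : Fin d → ℕ) :
    Measurable fun θ => (((residue α '' {t | (θ, t) ∈ C}).encard : ℕ∞) : ℝ≥0∞) := by
  simp only [encard_residue_image_eq]
  exact Finset.measurable_sum _ fun r _ =>
    measurable_one.indicator (isClosed_hits hC α r).measurableSet

theorem measurable_encard_fiber {C : Set (Θ × (Fin d → ℤ_[p]))} (hC : IsClosed C) :
    Measurable fun θ => ((({t | (θ, t) ∈ C} : Set (Fin d → ℤ_[p])).encard : ℕ∞) : ℝ≥0∞) := by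
  simp only [← iSup_encard_residue_image 0]
  exact Measurable.iSup fun n => measurable_encard_residue_image hC _

theorem tendsto_sum_measure_hits (μ : Measure Θ) {C : Set (Θ × (Fin d → ℤ_[p]))}
    (hC : IsClosed C) (w : Fin d → ℕ) :
    Filter.Tendsto (fun n : ℕ => ∑ r, μ (hits C (fun j => n + w j) r)) Filter.atTop
      (nhds (∫⁻ θ, ((({t | (θ, t) ∈ C} : Set (Fin d → ℤ_[p])).encard : ℕ∞) : ℝ≥0∞) ∂μ)) := by
  have hmono : Monotone fun (n : ℕ) (θ : Θ) =>
      (((residue (fun j => n + w j) '' {t | (θ, t) ∈ C}).encard : ℕ∞) : ℝ≥0∞) := by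
    intro n m hnm θ
    have : (fun j => n + w j) ≤ fun j => m + w j := fun j => by simpa using hnm
    exact ENat.toENNReal_le.2 (encard_residue_image_mono this _)
  have hint : ∀ n : ℕ, ∑ r, μ (hits C (fun j => n + w j) r) =
      ∫⁻ θ, (((residue (fun j => n + w j) '' {t | (θ, t) ∈ C}).encard : ℕ∞) : ℝ≥0∞) ∂μ := by
    intro n
    have hm := fun r => (isClosed_hits hC (fun j => n + w j) r).measurableSet
    simp only [encard_residue_image_eq]
    rw [lintegral_finsetSum _ fun r _ => measurable_one.indicator (hm r)]
    exact Finset.sum_congr rfl fun r _ => (lintegral_indicator_one (hm r)).symm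
  simp only [hint, ← iSup_encard_residue_image w]
  rw [lintegral_iSup (fun n => measurable_encard_residue_image hC _) hmono]
  exact tendsto_atTop_iSup fun n m hnm => lintegral_mono (hmono hnm)

end Counting

section Hensel

variable {p : ℕ} [Fact p.Prime] {d : ℕ}

theorem norm_mulVec_le (A : Matrix (Fin d) (Fin d) ℤ_[p]) (v : Fin d → ℤ_[p]) :
    ‖A.mulVec v‖ ≤ ‖v‖ := by
  refine (pi_norm_le_iff_of_nonneg (norm_nonneg v)).2 fun i => ?_
  rw [Matrix.mulVec, dotProduct]
  refine IsUltrametricDist.norm_sum_le_of_forall_le_of_nonneg (norm_nonneg v) fun j _ => ?_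
  rw [norm_mul]
  refine (mul_le_of_le_one_left (norm_nonneg _) (PadicInt.norm_le_one _)).trans ?_
  exact norm_le_pi_norm v j

/-- A perturbation of a nonsingular linear map by a sufficiently small Lipschitz map has the same
image. -/
theorem range_linear_add_small (U : Matrix (Fin d) (Fin d) ℤ_[p]) (M : ℕ)
    (hU : U.det ∣ (p : ℤ_[p]) ^ M) (e : (Fin d → ℤ_[p]) → Fin d → ℤ_[p]) (he : LipschitzWith 1 e) :
    Set.range (fun s => U.mulVec s + (p : ℤ_[p]) ^ (M + 1) • e s) = Set.range U.mulVec := by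
  obtain ⟨g, hg⟩ := hU
  let R : (Fin d → ℤ_[p]) → Fin d → ℤ_[p] := fun s => ((p : ℤ_[p]) * g) • U.adjugate.mulVec (e s)
  have hR : ∀ s, U.mulVec (R s) = (p : ℤ_[p]) ^ (M + 1) • e s := by
    intro s
    simp only [R, Matrix.mulVec_smul, Matrix.mulVec_mulVec, Matrix.mul_adjugate,
      Matrix.smul_mulVec, Matrix.one_mulVec, smul_smul, pow_succ, hg]
    congr 1
    ring
  have hRL : ∀ s s', dist (R s) (R s') ≤ (p : ℝ)⁻¹ * dist s s' := by
    intro s s'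
    rw [dist_eq_norm, ← smul_sub, ← Matrix.mulVec_sub, norm_smul, norm_mul, PadicInt.norm_p]
    have h1 := he.dist_le_mul s s'
    rw [dist_eq_norm, NNReal.coe_one, one_mul] at h1
    have hp : (0 : ℝ) ≤ (p : ℝ)⁻¹ := by positivity
    calc (p : ℝ)⁻¹ * ‖g‖ * ‖U.adjugate.mulVec (e s - e s')‖
        ≤ (p : ℝ)⁻¹ * 1 * dist s s' := by
          gcongr
          · exact PadicInt.norm_le_one _
          · exact (norm_mulVec_le _ _).trans h1
      _ = _ := by ring
  refine Set.Subset.antisymm ?_ ?_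
  · rintro _ ⟨s, rfl⟩
    exact ⟨s + R s, by simp only [Matrix.mulVec_add, hR]⟩
  · rintro _ ⟨v, rfl⟩
    have hcontr : ContractingWith (p : NNReal)⁻¹ fun s => v - R s := by
      refine ⟨?_, LipschitzWith.of_dist_le_mul fun s s' => ?_⟩
      · exact inv_lt_one_of_one_lt₀ (by exact_mod_cast (Fact.out : p.Prime).one_lt)
      · rw [dist_sub_left]
        simpa using hRL s s'
    obtain ⟨s, hs, -⟩ := hcontr.exists_fixedPoint 0 (edist_ne_top _ _)
    refine ⟨s, ?_⟩
    have hs' : v = s + R s := by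
      rw [Function.IsFixedPt, sub_eq_iff_eq_add] at hs
      exact hs
    simp only [hs', Matrix.mulVec_add, hR]

end Hensel

section System

variable {p : ℕ} [Fact p.Prime] {d : ℕ} {ι : Type*} [Fintype ι]

/-- The random system with coefficients `z` with respect to the functions `f k`. -/
noncomputable def sysVal (f : ι → (Fin d → ℤ_[p]) → ℤ_[p]) (z : Fin d × ι → ℤ_[p])
    (t : Fin d → ℤ_[p]) : Fin d → ℤ_[p] :=
  fun i => ∑ k, z (i, k) * f k t

/-- The value and the (scaled) derivative at a point of the random system. -/
noncomputable def sysJet (c : ι → ℤ_[p]) (V : ι → Fin d → ℤ_[p]) :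
    (Fin d × ι → ℤ_[p]) →+ VecMat p d where
  toFun z := (fun i => ∑ k, z (i, k) * c k, fun i j => ∑ k, z (i, k) * V k j)
  map_zero' := by ext <;> simp
  map_add' x y := by ext <;> simp [add_mul, Finset.sum_add_distrib]

theorem measurePreserving_sysJet (c : ι → ℤ_[p]) (V : ι → Fin d → ℤ_[p])
    (h : ∀ (y : ℤ_[p]) (u : Fin d → ℤ_[p]), ∃ ζ : ι → ℤ_[p],
      ∑ k, ζ k * c k = y ∧ ∀ j, ∑ k, ζ k * V k j = u j) :
    MeasurePreserving (sysJet c V) := by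
  refine measurePreserving_of_surjective _ ?_ fun x => ?_
  · change Continuous fun z : Fin d × ι → ℤ_[p] =>
      ((fun i => ∑ k, z (i, k) * c k, fun i j => ∑ k, z (i, k) * V k j) : VecMat p d)
    fun_prop
  · choose ζ hζ using fun i => h (x.1 i) (x.2 i)
    refine ⟨fun ik => ζ ik.1 ik.2, ?_⟩
    ext
    · exact (hζ _).1
    · exact (hζ _).2 _

/-- The matrices with determinant smaller than `p ^ M`. -/
def smallDet (p : ℕ) [Fact p.Prime] (d M : ℕ) : Set (Fin d → Fin d → ℤ_[p]) :=
  {U | ‖(Matrix.of U).det‖ < ‖(p : ℤ_[p]) ^ M‖}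

theorem measurableSet_smallDet (M : ℕ) : MeasurableSet (smallDet p d M) :=
  (isOpen_lt (Continuous.norm (Continuous.matrix_det (by fun_prop)))
    continuous_const).measurableSet

theorem tendsto_volume_smallDet :
    Filter.Tendsto (fun M => volume (smallDet p d M)) Filter.atTop (nhds 0) := by
  have hp : (1 : ℝ) < p := by exact_mod_cast (Fact.out : p.Prime).one_lt
  have hanti : Antitone (smallDet p d) := by
    intro M N h U hU
    simp only [smallDet, Set.mem_ofPred_eq, norm_pow, PadicInt.norm_p] at hU ⊢
    refine lt_of_lt_of_le hU ?_
    exact pow_le_pow_of_le_one (by positivity) (inv_le_one_of_one_le₀ hp.le) h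
  have hinter : ⋂ M, smallDet p d M ⊆ {U | (Matrix.of U).det = 0} := by
    intro U hU
    by_contra h0
    obtain ⟨n, hn⟩ := PadicInt.exists_pow_neg_lt p (norm_pos_iff.2 h0)
    have := Set.mem_iInter.1 hU n
    simp only [smallDet, Set.mem_ofPred_eq, PadicInt.norm_p_pow] at this
    exact absurd this (not_lt.2 hn.le)
  have := tendsto_measure_iInter_atTop (μ := volume)
    (fun M => (measurableSet_smallDet (p := p) (d := d) M).nullMeasurableSet) hanti
    ⟨0, measure_ne_top _ _⟩
  rwa [measure_mono_null hinter volume_det_eq_zero] at this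

/-- The pairs `(y, U)` with `p ^ m ∣ y` and `U` of small determinant. -/
def exceptional (p : ℕ) [Fact p.Prime] (d m M : ℕ) : Set (VecMat p d) :=
  {y | residue (fun _ => m) y = 0} ×ˢ smallDet p d M

theorem volume_exceptional (m M : ℕ) :
    (p : ℝ≥0∞) ^ (m * d) * volume (exceptional p d m M) = volume (smallDet p d M) := by
  have h := volume_residue_fiber (p := p) (fun _ : Fin d => m)
  simp only [Finset.sum_const, Finset.card_univ, Fintype.card_fin, smul_eq_mul] at h
  rw [exceptional, Measure.volume_eq_prod, Measure.prod_prod, ← mul_assoc, mul_comm m d, h, one_mul]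

variable (f : ι → (Fin d → ℤ_[p]) → ℤ_[p]) (V : ι → (Fin d → ℤ_[p]) → Fin d → ℤ_[p])

/-- On a box on which the system is close to its linearization, having a solution is equivalent to
the lattice event for the jet at the centre, up to the exceptional event. -/
theorem box_event {m M : ℕ} {α : Fin d → ℕ} {t : Fin d → ℤ_[p]}
    (ht : ∀ k, ∃ e : (Fin d → ℤ_[p]) → ℤ_[p], LipschitzWith 1 e ∧ ∀ s,
      f k (t + pScale α s) = f k t + (p : ℤ_[p]) ^ m *
        (∑ j, V k t j * s j + (p : ℤ_[p]) ^ (M + 1) * e s))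
    (x : Fin d → ℤ_[p]) (z : Fin d × ι → ℤ_[p]) :
    ((∃ s, sysVal f z (t + pScale α s) = x) →
      sysJet (fun k => f k t) (fun k => V k t) z + (-x, 0) ∈
        lat (fun _ => m) ∪ exceptional p d m M) ∧
    (sysJet (fun k => f k t) (fun k => V k t) z + (-x, 0) ∈ lat (fun _ => m) →
      (∃ s, sysVal f z (t + pScale α s) = x) ∨
      sysJet (fun k => f k t) (fun k => V k t) z + (-x, 0) ∈ exceptional p d m M) := by
  choose e he hfe using ht
  set y := (sysJet (fun k => f k t) (fun k => V k t) z).1 with hy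
  set U := (sysJet (fun k => f k t) (fun k => V k t) z).2 with hU
  have hjet : sysJet (fun k => f k t) (fun k => V k t) z + (-x, 0) = (y - x, U) := by
    ext <;> simp [hy, hU, sub_eq_add_neg]
  rw [hjet]
  let E : (Fin d → ℤ_[p]) → Fin d → ℤ_[p] := fun s i => ∑ k, z (i, k) * e k s
  have hE : LipschitzWith 1 E := by
    refine LipschitzWith.of_dist_le_mul fun s s' => ?_
    rw [NNReal.coe_one, one_mul]
    refine (dist_pi_le_iff dist_nonneg).2 fun i => ?_
    rw [dist_eq_norm, ← Finset.sum_sub_distrib]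
    refine IsUltrametricDist.norm_sum_le_of_forall_le_of_nonneg dist_nonneg fun k _ => ?_
    rw [← mul_sub, norm_mul, ← dist_eq_norm]
    refine (mul_le_of_le_one_left dist_nonneg (PadicInt.norm_le_one _)).trans ?_
    simpa using (he k).dist_le_mul s s'
  have hval : ∀ s, sysVal f z (t + pScale α s) =
      y + (p : ℤ_[p]) ^ m • ((Matrix.of U).mulVec s + (p : ℤ_[p]) ^ (M + 1) • E s) := by
    intro s
    ext i
    simp only [sysVal, hfe, hy, hU, sysJet, AddMonoidHom.coe_mk, ZeroHom.coe_mk, Pi.add_apply,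
      Pi.smul_apply, smul_eq_mul, Matrix.mulVec, dotProduct, Matrix.of_apply, E]
    simp only [mul_add, Finset.sum_add_distrib, Finset.mul_sum, Finset.sum_mul]
    rw [Finset.sum_comm]
    congr 1
    congr 1
    · exact Finset.sum_congr rfl fun _ _ => Finset.sum_congr rfl fun _ _ => by ring
    · exact Finset.sum_congr rfl fun _ _ => by ring
  have hscale : ∀ v : Fin d → ℤ_[p], pScale (fun _ => m) v = (p : ℤ_[p]) ^ m • v := fun v => rfl
  have hgood : U ∉ smallDet p d M →
      ((∃ s, sysVal f z (t + pScale α s) = x) ↔ (y - x, U) ∈ lat (fun _ => m)) := by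
    intro hU'
    have hrange := range_linear_add_small (Matrix.of U) M
      (dvd_of_norm_le (not_lt.1 hU')) E hE
    simp only [hval, lat, Set.mem_ofPred_eq, hscale, Matrix.mulVec_smul]
    constructor
    · rintro ⟨s, hs⟩
      obtain ⟨v, hv⟩ : _ ∈ Set.range (Matrix.of U).mulVec := hrange ▸ Set.mem_range_self s
      refine ⟨-v, ?_⟩
      rw [Matrix.mulVec_neg, hv, ← hs]
      simp
    · rintro ⟨v, hv⟩
      obtain ⟨s, hs⟩ : (Matrix.of U).mulVec (-v) ∈ Set.range fun s =>
        (Matrix.of U).mulVec s + (p : ℤ_[p]) ^ (M + 1) • E s := hrange ▸ Set.mem_range_self _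
      refine ⟨s, ?_⟩
      simp only at hs
      rw [hs, Matrix.mulVec_neg, smul_neg, ← hv]
      simp
  have hres : ∀ v : Fin d → ℤ_[p], y - x = (p : ℤ_[p]) ^ m • v →
      residue (fun _ => m) (y - x) = 0 := by
    intro v hv
    have : residue (fun _ => m) (y - x) = residue (fun _ => m) (0 : Fin d → ℤ_[p]) :=
      residue_eq_iff.2 ⟨v, by rw [hv, hscale, zero_add]⟩
    rw [this]
    ext; simp [residue]
  constructor
  · intro hs
    by_cases hU' : U ∈ smallDet p d M
    · obtain ⟨s, hs⟩ := hs
      refine Or.inr ⟨hres (-((Matrix.of U).mulVec s + (p : ℤ_[p]) ^ (M + 1) • E s)) ?_, hU'⟩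
      rw [← hs, hval]
      simp
    · exact Or.inl ((hgood hU').1 hs)
  · intro hl
    by_cases hU' : U ∈ smallDet p d M
    · obtain ⟨v, hv⟩ := hl
      refine Or.inr ⟨hres ((Matrix.of U).mulVec v) ?_, hU'⟩
      rw [← Matrix.mulVec_smul]
      exact hv
    · exact Or.inl ((hgood hU').2 hl)

theorem volume_box {m M : ℕ} {α : Fin d → ℕ} {t : Fin d → ℤ_[p]}
    (ht : ∀ k, ∃ e : (Fin d → ℤ_[p]) → ℤ_[p], LipschitzWith 1 e ∧ ∀ s,
      f k (t + pScale α s) = f k t + (p : ℤ_[p]) ^ m *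
        (∑ j, V k t j * s j + (p : ℤ_[p]) ^ (M + 1) * e s))
    (hsurj : ∀ (y : ℤ_[p]) (u : Fin d → ℤ_[p]), ∃ ζ : ι → ℤ_[p],
      ∑ k, ζ k * f k t = y ∧ ∀ j, ∑ k, ζ k * V k t j = u j)
    (x : Fin d → ℤ_[p]) :
    (p : ℝ≥0∞) ^ (m * d) * volume {z | ∃ s, sysVal f z (t + pScale α s) = x} ≤
        volume (lat (p := p) (0 : Fin d → ℕ)) + volume (smallDet p d M) ∧
      volume (lat (p := p) (0 : Fin d → ℕ)) ≤
        (p : ℝ≥0∞) ^ (m * d) * volume {z | ∃ s, sysVal f z (t + pScale α s) = x} +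
          volume (smallDet p d M) := by
  have hT : MeasurePreserving fun z =>
      sysJet (fun k => f k t) (fun k => V k t) z + ((-x, 0) : VecMat p d) :=
    (measurePreserving_add_right volume ((-x, 0) : VecMat p d)).comp
      (measurePreserving_sysJet _ _ hsurj)
  have hlm : MeasurableSet (lat (p := p) fun _ : Fin d => m) := (isClosed_lat _).measurableSet
  have hem : MeasurableSet (exceptional p d m M) :=
    (isClosed_residue_fiber _ _).measurableSet.prod (measurableSet_smallDet M)
  have hlat : (p : ℝ≥0∞) ^ (m * d) * volume (lat (p := p) fun _ : Fin d => m) =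
      volume (lat (p := p) (0 : Fin d → ℕ)) := by
    rw [← volume_lat fun _ : Fin d => m]
    simp [mul_comm]
  have h1 := hT.measure_preimage hlm.nullMeasurableSet
  have h2 := hT.measure_preimage hem.nullMeasurableSet
  have hbox := box_event f V ht x
  rw [← hlat, ← volume_exceptional m M, ← h1, ← h2, ← mul_add, ← mul_add]
  constructor
  · gcongr
    exact (measure_mono fun z hz => (hbox z).1 hz).trans (measure_union_le _ _)
  · gcongr
    exact (measure_mono fun z hz => (hbox z).2 hz).trans (measure_union_le _ _)

/-- The expected number of solutions of a random system whose values and scaled derivatives are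
uniformly distributed at each point. -/
theorem lintegral_encard_solutions (hf : ∀ k, Continuous (f k)) (w : Fin d → ℕ) (n₀ : ℕ)
    (htaylor : ∀ M, ∃ N, ∀ n ≥ N, ∀ t k, ∃ e : (Fin d → ℤ_[p]) → ℤ_[p], LipschitzWith 1 e ∧ ∀ s,
      f k (t + pScale (fun j => n + w j) s) = f k t + (p : ℤ_[p]) ^ (n + n₀) *
        (∑ j, V k t j * s j + (p : ℤ_[p]) ^ (M + 1) * e s))
    (hsurj : ∀ t (y : ℤ_[p]) (u : Fin d → ℤ_[p]), ∃ ζ : ι → ℤ_[p],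
      ∑ k, ζ k * f k t = y ∧ ∀ j, ∑ k, ζ k * V k t j = u j)
    (x : Fin d → ℤ_[p]) :
    (p : ℝ≥0∞) ^ (n₀ * d) *
        ∫⁻ z, ((({t | sysVal f z t = x} : Set (Fin d → ℤ_[p])).encard : ℕ∞) : ℝ≥0∞) =
      (p : ℝ≥0∞) ^ (∑ j, w j) * volume (lat (p := p) (0 : Fin d → ℕ)) := by
  let C : Set ((Fin d × ι → ℤ_[p]) × (Fin d → ℤ_[p])) := {q | sysVal f q.1 q.2 = x}
  have hC : IsClosed C := by
    refine isClosed_eq ?_ continuous_const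
    unfold sysVal
    fun_prop
  have hlim := tendsto_sum_measure_hits volume hC w
  set E := ∫⁻ z, ((({t | (z, t) ∈ C} : Set (Fin d → ℤ_[p])).encard : ℕ∞) : ℝ≥0∞)
  set a : ℕ → ℝ≥0∞ := fun n => ∑ r, volume (hits C (fun j => n + w j) r)
  set Q := volume (lat (p := p) (0 : Fin d → ℕ))
  have hp0 : (p : ℝ≥0∞) ≠ 0 := by simpa using (Fact.out : p.Prime).ne_zero
  have hpt : (p : ℝ≥0∞) ≠ ⊤ := ENNReal.natCast_ne_top p
  have hstep : ∀ M, ∀ᶠ n : ℕ in Filter.atTop,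
      (p : ℝ≥0∞) ^ (n₀ * d) * a n ≤
        (p : ℝ≥0∞) ^ (∑ j, w j) * (Q + volume (smallDet p d M)) ∧
      (p : ℝ≥0∞) ^ (∑ j, w j) * Q ≤ (p : ℝ≥0∞) ^ (n₀ * d) * a n +
        (p : ℝ≥0∞) ^ (∑ j, w j) * volume (smallDet p d M) := by
    intro M
    obtain ⟨N, hN⟩ := htaylor M
    filter_upwards [Filter.eventually_ge_atTop N] with n hn
    have hbox : ∀ r, (p : ℝ≥0∞) ^ ((n + n₀) * d) * volume (hits C (fun j => n + w j) r) ≤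
        Q + volume (smallDet p d M) ∧
        Q ≤ (p : ℝ≥0∞) ^ ((n + n₀) * d) * volume (hits C (fun j => n + w j) r) +
          volume (smallDet p d M) := by
      intro r
      obtain ⟨t, rfl⟩ := residue_surjective (p := p) _ r
      have : hits C (fun j => n + w j) (residue (fun j => n + w j) t) =
          {z | ∃ s, sysVal f z (t + pScale (fun j => n + w j) s) = x} := by
        ext z
        simp only [hits, residue_eq_iff, C, Set.mem_ofPred_eq]
        constructor
        · rintro ⟨_, ⟨s, rfl⟩, h⟩
          exact ⟨s, h⟩
        · rintro ⟨s, h⟩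
          exact ⟨_, ⟨s, rfl⟩, h⟩
      rw [this]
      exact volume_box f V (hN n hn t) (hsurj t) x
    have hcard : ∀ c : ℝ≥0∞, ∑ _r : (∀ j, ZMod (p ^ (n + w j))), c =
        (p : ℝ≥0∞) ^ (n * d) * ((p : ℝ≥0∞) ^ (∑ j, w j) * c) := by
      intro c
      rw [Finset.sum_const, Finset.card_univ, card_residue, nsmul_eq_mul, ← mul_assoc, ← pow_add,
        Finset.sum_add_distrib]
      simp [mul_comm]
    have hn0 : (p : ℝ≥0∞) ^ (n * d) ≠ 0 := pow_ne_zero _ hp0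
    have hnt : (p : ℝ≥0∞) ^ (n * d) ≠ ⊤ := ENNReal.pow_ne_top hpt
    constructor
    · rw [← ENNReal.mul_le_mul_iff_right hn0 hnt, ← hcard, ← mul_assoc, ← pow_add, ← add_mul,
        Finset.mul_sum]
      exact Finset.sum_le_sum fun r _ => (hbox r).1
    · rw [← ENNReal.mul_le_mul_iff_right hn0 hnt, mul_add, ← hcard, ← hcard, ← mul_assoc,
        ← pow_add, ← add_mul, Finset.mul_sum, ← Finset.sum_add_distrib]
      exact Finset.sum_le_sum fun r _ => (hbox r).2
  have hlim' : Filter.Tendsto (fun n => (p : ℝ≥0∞) ^ (n₀ * d) * a n) Filter.atTop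
      (nhds ((p : ℝ≥0∞) ^ (n₀ * d) * E)) :=
    ENNReal.Tendsto.const_mul hlim (Or.inr (ENNReal.pow_ne_top hpt))
  have hW : (p : ℝ≥0∞) ^ (∑ j, w j) ≠ ⊤ := ENNReal.pow_ne_top hpt
  have hsmall := tendsto_volume_smallDet (p := p) (d := d)
  refine le_antisymm ?_ ?_
  · have h1 : ∀ M, (p : ℝ≥0∞) ^ (n₀ * d) * E ≤
        (p : ℝ≥0∞) ^ (∑ j, w j) * (Q + volume (smallDet p d M)) := fun M =>
      le_of_tendsto hlim' ((hstep M).mono fun n hn => hn.1)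
    have h2 := ENNReal.Tendsto.const_mul (hsmall.const_add Q) (Or.inr hW)
    rw [add_zero] at h2
    exact ge_of_tendsto' h2 h1
  · have h1 : ∀ M, (p : ℝ≥0∞) ^ (∑ j, w j) * Q ≤ (p : ℝ≥0∞) ^ (n₀ * d) * E +
        (p : ℝ≥0∞) ^ (∑ j, w j) * volume (smallDet p d M) := fun M =>
      ge_of_tendsto (hlim'.add_const _) ((hstep M).mono fun n hn => hn.2)
    have h2 := (ENNReal.Tendsto.const_mul hsmall (Or.inr hW)).const_add ((p : ℝ≥0∞) ^ (n₀ * d) * E)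
    rw [mul_zero, add_zero] at h2
    exact ge_of_tendsto' h2 h1

end System

section Taylor

variable {p : ℕ} [Fact p.Prime] {d : ℕ}

theorem norm_sum_mul_sub_le {v : Fin d → ℚ_[p]} {C : ℝ} (hC : 0 ≤ C) (hv : ∀ j, ‖v j‖ ≤ C)
    (h h' : Fin d → ℤ_[p]) : ‖∑ j, v j * ((h j : ℚ_[p]) - h' j)‖ ≤ C * ‖h - h'‖ := by
  refine IsUltrametricDist.norm_sum_le_of_forall_le_of_nonneg (by positivity) fun j _ => ?_
  rw [norm_mul, ← PadicInt.coe_sub, ← PadicInt.norm_def]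
  exact mul_le_mul (hv j) (norm_le_pi_norm (h - h') j) (norm_nonneg _) hC

/-- `ψ t h` is a function of the increment `h`, whose derivative at `h = 0` is `v t`, with a
quadratic error estimate that is uniform in `t`. -/
def Approx (ψ : (Fin d → ℤ_[p]) → (Fin d → ℤ_[p]) → ℚ_[p])
    (v : (Fin d → ℤ_[p]) → Fin d → ℚ_[p]) : Prop :=
  ∃ C : ℝ, 0 ≤ C ∧ (∀ t h, ‖ψ t h‖ ≤ C) ∧ (∀ t j, ‖v t j‖ ≤ C) ∧
    ∀ t h h', ‖ψ t h - ψ t h' - ∑ j, v t j * ((h j : ℚ_[p]) - h' j)‖ ≤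
      C * max ‖h‖ ‖h'‖ * ‖h - h'‖

theorem norm_padicInt_vec_le_one (h : Fin d → ℤ_[p]) : ‖h‖ ≤ 1 :=
  (pi_norm_le_iff_of_nonneg zero_le_one).2 fun _ => PadicInt.norm_le_one _

theorem Approx.const {c : (Fin d → ℤ_[p]) → ℚ_[p]} {B : ℝ} (hB : ∀ t, ‖c t‖ ≤ B) :
    Approx (fun t _ => c t) fun _ _ => 0 := by
  have h0 : 0 ≤ B := (norm_nonneg _).trans (hB 0)
  refine ⟨B, h0, fun t _ => hB t, fun _ _ => by simpa using h0, fun t h h' => ?_⟩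
  simp only [sub_self, zero_mul, Finset.sum_const_zero, norm_zero]
  positivity

theorem Approx.coord (j : Fin d) :
    Approx (p := p) (fun _ h => (h j : ℚ_[p])) fun _ j' => if j' = j then 1 else 0 := by
  refine ⟨1, zero_le_one, fun _ h => ?_, fun _ j' => ?_, fun t h h' => ?_⟩
  · rw [← PadicInt.norm_def]
    exact PadicInt.norm_le_one _
  · dsimp only
    split_ifs <;> simp
  · simp only [ite_mul, one_mul, zero_mul, Finset.sum_ite_eq', Finset.mem_univ, if_true, sub_self,
      norm_zero]
    positivity

theorem Approx.add {ψ χ : (Fin d → ℤ_[p]) → (Fin d → ℤ_[p]) → ℚ_[p]}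
    {v u : (Fin d → ℤ_[p]) → Fin d → ℚ_[p]} (hψ : Approx ψ v) (hχ : Approx χ u) :
    Approx (fun t h => ψ t h + χ t h) fun t j => v t j + u t j := by
  obtain ⟨C, hC, h1, h2, h3⟩ := hψ
  obtain ⟨D, hD, k1, k2, k3⟩ := hχ
  refine ⟨C + D, by positivity, fun t h => (norm_add_le _ _).trans (add_le_add (h1 t h) (k1 t h)),
    fun t j => (norm_add_le _ _).trans (add_le_add (h2 t j) (k2 t j)), fun t h h' => ?_⟩
  have : ψ t h + χ t h - (ψ t h' + χ t h') - ∑ j, (v t j + u t j) * ((h j : ℚ_[p]) - h' j) =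
      (ψ t h - ψ t h' - ∑ j, v t j * ((h j : ℚ_[p]) - h' j)) +
        (χ t h - χ t h' - ∑ j, u t j * ((h j : ℚ_[p]) - h' j)) := by
    simp only [add_mul, Finset.sum_add_distrib]
    ring
  rw [this, add_mul, add_mul]
  exact (norm_add_le _ _).trans (add_le_add (h3 t h h') (k3 t h h'))

theorem Approx.sum {κ : Type*} (S : Finset κ)
    {ψ : κ → (Fin d → ℤ_[p]) → (Fin d → ℤ_[p]) → ℚ_[p]}
    {v : κ → (Fin d → ℤ_[p]) → Fin d → ℚ_[p]} (h : ∀ k ∈ S, Approx (ψ k) (v k)) :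
    Approx (fun t h => ∑ k ∈ S, ψ k t h) fun t j => ∑ k ∈ S, v k t j := by
  classical
  induction S using Finset.induction_on with
  | empty => simpa using Approx.const (p := p) (d := d) (c := fun _ => 0) (B := 0) (by simp)
  | insert k S hk ih =>
    simp only [Finset.sum_insert hk]
    exact (h k (Finset.mem_insert_self _ _)).add
      (ih fun k' hk' => h k' (Finset.mem_insert_of_mem hk'))

theorem Approx.mul {ψ χ : (Fin d → ℤ_[p]) → (Fin d → ℤ_[p]) → ℚ_[p]}
    {v u : (Fin d → ℤ_[p]) → Fin d → ℚ_[p]} (hψ : Approx ψ v) (hχ : Approx χ u) :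
    Approx (fun t h => ψ t h * χ t h) fun t j => ψ t 0 * u t j + χ t 0 * v t j := by
  obtain ⟨C, hC, h1, h2, h3⟩ := hψ
  obtain ⟨D, hD, k1, k2, k3⟩ := hχ
  have lip : ∀ (ξ : (Fin d → ℤ_[p]) → ℚ_[p]) (s : Fin d → ℚ_[p]) (B : ℝ), 0 ≤ B →
      (∀ j, ‖s j‖ ≤ B) → (∀ h h' : Fin d → ℤ_[p],
        ‖ξ h - ξ h' - ∑ j, s j * ((h j : ℚ_[p]) - h' j)‖ ≤ B * max ‖h‖ ‖h'‖ * ‖h - h'‖) →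
      ∀ h, ‖ξ h - ξ 0‖ ≤ B * ‖h‖ := by
    intro ξ s B hB hs hξ h
    have e1 := hξ h 0
    have e2 := norm_sum_mul_sub_le hB hs h 0
    rw [sub_zero] at e1 e2
    rw [← sub_add_cancel (ξ h - ξ 0) (∑ j, s j * ((h j : ℚ_[p]) - (0 : Fin d → ℤ_[p]) j))]
    refine (IsUltrametricDist.norm_add_le_max _ _).trans (max_le (e1.trans ?_) e2)
    rw [norm_zero, max_eq_left (norm_nonneg _)]
    refine mul_le_mul_of_nonneg_right ?_ (norm_nonneg _)
    exact mul_le_of_le_one_right hB (norm_padicInt_vec_le_one h)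
  refine ⟨4 * (C * D), by positivity, fun t h => ?_, fun t j => ?_, fun t h h' => ?_⟩
  · rw [norm_mul]
    nlinarith [mul_le_mul (h1 t h) (k1 t h) (norm_nonneg _) hC, mul_nonneg hC hD]
  · refine (norm_add_le _ _).trans ?_
    rw [norm_mul, norm_mul]
    nlinarith [mul_le_mul (h1 t 0) (k2 t j) (norm_nonneg _) hC,
      mul_le_mul (k1 t 0) (h2 t j) (norm_nonneg _) hD, mul_nonneg hC hD]
  · set m := max ‖h‖ ‖h'‖
    set Lu := ∑ j, u t j * ((h j : ℚ_[p]) - h' j)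
    set Lv := ∑ j, v t j * ((h j : ℚ_[p]) - h' j)
    have hsum : ∑ j, (ψ t 0 * u t j + χ t 0 * v t j) * ((h j : ℚ_[p]) - h' j) =
        ψ t 0 * Lu + χ t 0 * Lv := by
      simp only [Lu, Lv, Finset.mul_sum, ← Finset.sum_add_distrib]
      exact Finset.sum_congr rfl fun _ _ => by ring
    have hid : ψ t h * χ t h - ψ t h' * χ t h' - (ψ t 0 * Lu + χ t 0 * Lv) =
        ψ t h * (χ t h - χ t h' - Lu) + χ t h' * (ψ t h - ψ t h' - Lv) +
          (ψ t h - ψ t 0) * Lu + (χ t h' - χ t 0) * Lv := by ring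
    have hm : 0 ≤ m := (norm_nonneg h).trans (le_max_left _ _)
    have b1 : ‖ψ t h * (χ t h - χ t h' - Lu)‖ ≤ C * (D * m * ‖h - h'‖) := by
      rw [norm_mul]
      exact mul_le_mul (h1 t h) (k3 t h h') (norm_nonneg _) hC
    have b2 : ‖χ t h' * (ψ t h - ψ t h' - Lv)‖ ≤ D * (C * m * ‖h - h'‖) := by
      rw [norm_mul]
      exact mul_le_mul (k1 t h') (h3 t h h') (norm_nonneg _) hD
    have b3 : ‖(ψ t h - ψ t 0) * Lu‖ ≤ (C * m) * (D * ‖h - h'‖) := by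
      rw [norm_mul]
      refine mul_le_mul ((lip _ _ C hC (h2 t) (h3 t) h).trans ?_)
        (norm_sum_mul_sub_le hD (k2 t) h h') (norm_nonneg _) (by positivity)
      exact mul_le_mul_of_nonneg_left (le_max_left _ _) hC
    have b4 : ‖(χ t h' - χ t 0) * Lv‖ ≤ (D * m) * (C * ‖h - h'‖) := by
      rw [norm_mul]
      refine mul_le_mul ((lip _ _ D hD (k2 t) (k3 t) h').trans ?_)
        (norm_sum_mul_sub_le hC (h2 t) h h') (norm_nonneg _) (by positivity)
      exact mul_le_mul_of_nonneg_left (le_max_right _ _) hD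
    rw [hsum, hid]
    refine (norm_add_le _ _).trans ((add_le_add ((norm_add_le _ _).trans
      (add_le_add ((norm_add_le _ _).trans (add_le_add b1 b2)) b3)) b4).trans (le_of_eq ?_))
    ring

/-- The derivative at `0` of `binom(h, i)`. -/
noncomputable def chooseDerivZero (p : ℕ) [Fact p.Prime] : ℕ → ℚ_[p]
  | 0 => 0
  | i + 1 => (-1) ^ i / (i + 1 : ℕ)

/-- The derivative of `binom(t, n)`. -/
noncomputable def chooseDeriv (n : ℕ) (t : ℤ_[p]) : ℚ_[p] :=
  ∑ ij ∈ Finset.HasAntidiagonal.antidiagonal n, (Ring.choose t ij.1 : ℤ_[p]) * chooseDerivZero p ij.2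

theorem succ_mul_choose_succ (h : ℤ_[p]) (i : ℕ) :
    ((i + 1 : ℕ) : ℤ_[p]) * Ring.choose h (i + 1) = (h - i) * Ring.choose h i := by
  have := Ring.choose_smul_choose h (Nat.le_succ i)
  simpa [Ring.choose_one_right, mul_comm] using this

theorem norm_coe_le_one (x : ℤ_[p]) : ‖(x : ℚ_[p])‖ ≤ 1 := x.2

theorem approx_choose_increment (j : Fin d) (i : ℕ) :
    Approx (p := p) (fun _ h => ((Ring.choose (h j) i : ℤ_[p]) : ℚ_[p]))
      fun _ j' => if j' = j then chooseDerivZero p i else 0 := by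
  induction i with
  | zero =>
    simpa [Ring.choose_zero_right, chooseDerivZero] using
      Approx.const (p := p) (d := d) (c := fun _ => 1) (B := 1) (by simp)
  | succ i ih =>
    have hne : ((i + 1 : ℕ) : ℚ_[p]) ≠ 0 := by exact_mod_cast Nat.succ_ne_zero i
    have h1 := ((Approx.const (p := p) (d := d) (c := fun _ => -(i : ℚ_[p])) (fun _ => le_rfl)).add
      (Approx.coord j)).mul ih
    have h2 := (Approx.const (p := p) (d := d) (c := fun _ => ((i + 1 : ℕ) : ℚ_[p])⁻¹)
      (fun _ => le_rfl)).mul h1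
    convert h2 using 1
    · ext t h
      have := congrArg (fun x : ℤ_[p] => (x : ℚ_[p])) (succ_mul_choose_succ (h j) i)
      simp only [PadicInt.coe_mul, PadicInt.coe_natCast, PadicInt.coe_sub] at this
      rw [eq_inv_mul_iff_mul_eq₀ hne, this]
      ring
    · ext t j'
      split_ifs with hj
      · cases i with
        | zero => simp [chooseDerivZero]
        | succ i =>
          simp only [chooseDerivZero, Pi.zero_apply, Ring.choose_zero_succ, PadicInt.coe_zero]
          push_cast
          field_simp
          ring
      · simp

theorem approx_choose (j : Fin d) (n : ℕ) :
    Approx (p := p) (fun t h => ((Ring.choose (t j + h j) n : ℤ_[p]) : ℚ_[p]))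
      fun t j' => if j' = j then chooseDeriv n (t j) else 0 := by
  have := Approx.sum (p := p) (d := d) (Finset.HasAntidiagonal.antidiagonal n) fun ij _ =>
    (Approx.const (p := p) (d := d) (c := fun t => ((Ring.choose (t j) ij.1 : ℤ_[p]) : ℚ_[p]))
      (fun t => norm_coe_le_one _)).mul (approx_choose_increment j ij.2)
  convert this using 1
  · ext t h
    rw [Ring.add_choose_eq n (Commute.all _ _)]
    simp only [PadicInt.coe_sum, PadicInt.coe_mul]
  · ext t j'
    split_ifs with hj <;> simp [chooseDeriv]

theorem approx_prod_choose (k : Fin d → ℕ) (S : Finset (Fin d)) :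
    Approx (p := p) (fun t h => ∏ j ∈ S, ((Ring.choose (t j + h j) (k j) : ℤ_[p]) : ℚ_[p]))
      fun t j' => if j' ∈ S then
        (∏ j ∈ S.erase j', ((Ring.choose (t j) (k j) : ℤ_[p]) : ℚ_[p])) * chooseDeriv (k j') (t j')
        else 0 := by
  induction S using Finset.induction_on with
  | empty => simpa using Approx.const (p := p) (d := d) (c := fun _ => 1) (B := 1) (by simp)
  | insert i S hi ih =>
    convert (approx_choose i (k i)).mul ih using 1
    · ext t h
      rw [Finset.prod_insert hi]
    · ext t j'
      rcases eq_or_ne j' i with rfl | hne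
      · simp [hi]
      · by_cases hS : j' ∈ S
        · have : (insert i S).erase j' = insert i (S.erase j') :=
            Finset.erase_insert_of_ne hne.symm
          rw [if_pos (Finset.mem_insert_of_mem hS), this, Finset.prod_insert (by simp [hi])]
          simp [hS, hne, mul_assoc]
        · simp [hS, hne]

theorem norm_mul_chooseDeriv_le {c : ℚ_[p]} {B : ℝ} (hB : 0 ≤ B) {n : ℕ}
    (h : ∀ i, 1 ≤ i → i ≤ n → ‖c / (i : ℚ_[p])‖ ≤ B) (t : ℤ_[p]) :
    ‖c * chooseDeriv n t‖ ≤ B := by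
  rw [chooseDeriv, Finset.mul_sum]
  refine IsUltrametricDist.norm_sum_le_of_forall_le_of_nonneg hB fun ij hij => ?_
  rw [Finset.HasAntidiagonal.mem_antidiagonal] at hij
  rcases hj : ij.2 with _ | i
  · simpa [chooseDerivZero] using hB
  · have hi := h (i + 1) (by omega) (by omega)
    have : ‖c * chooseDerivZero p (i + 1)‖ ≤ B := by
      simpa [chooseDerivZero, norm_div, div_eq_mul_inv] using hi
    rw [mul_left_comm, norm_mul]
    exact (mul_le_of_le_one_left (norm_nonneg _) (norm_coe_le_one _)).trans this

theorem norm_chooseDeriv_prime_pow (r : ℕ) (t : ℤ_[p]) :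
    ‖chooseDeriv (p ^ r) t‖ = ‖(((p ^ r : ℕ) : ℚ_[p]))⁻¹‖ := by
  have hpos : 0 < p ^ r := pow_pos (Fact.out : p.Prime).pos r
  have hγ : ∀ i : ℕ, 0 < i → ‖chooseDerivZero p i‖ = ‖(i : ℚ_[p])⁻¹‖ := by
    intro i hi
    obtain ⟨i, rfl⟩ := Nat.exists_eq_succ_of_ne_zero hi.ne'
    simp [chooseDerivZero]
  have hmem : (0, p ^ r) ∈ Finset.HasAntidiagonal.antidiagonal (p ^ r) := by simp
  rw [chooseDeriv, ← Finset.add_sum_erase _ _ hmem, Ring.choose_zero_right, PadicInt.coe_one,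
    one_mul, ← hγ _ hpos]
  have hpr : ‖((p ^ r : ℕ) : ℚ_[p])‖ = (p : ℝ) ^ (-r : ℤ) := by
    push_cast
    exact Padic.norm_p_pow r
  have hp0 : (0 : ℝ) < p := by exact_mod_cast (Fact.out : p.Prime).pos
  have hlt : ‖∑ ij ∈ (Finset.HasAntidiagonal.antidiagonal (p ^ r)).erase (0, p ^ r),
      ((Ring.choose t ij.1 : ℤ_[p]) : ℚ_[p]) * chooseDerivZero p ij.2‖ <
      ‖chooseDerivZero p (p ^ r)‖ := by
    rcases ((Finset.HasAntidiagonal.antidiagonal (p ^ r)).erase (0, p ^ r)).eq_empty_or_nonempty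
      with hS | hS
    · rw [hS, Finset.sum_empty, norm_zero, hγ _ hpos, norm_inv, hpr]
      positivity
    · refine (hS.norm_sum_le_sup'_norm _).trans_lt ((Finset.sup'_lt_iff _).2 fun ij hij => ?_)
      rw [Finset.mem_erase, Finset.HasAntidiagonal.mem_antidiagonal] at hij
      rw [norm_mul]
      refine (mul_le_of_le_one_left (norm_nonneg _) (norm_coe_le_one _)).trans_lt ?_
      rcases Nat.eq_zero_or_pos ij.2 with h0 | hi
      · rw [h0, hγ _ hpos, norm_inv, hpr]
        simp only [chooseDerivZero, norm_zero]
        positivity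
      · rw [hγ _ hi, hγ _ hpos, norm_inv, norm_inv]
        have hne : ij.2 ≠ p ^ r := fun h => hij.1 (Prod.ext (by simp; omega) h)
        have hndvd : ¬ p ^ r ∣ ij.2 := Nat.not_dvd_of_pos_of_lt hi (by omega)
        have : ‖((p ^ r : ℕ) : ℚ_[p])‖ < ‖(ij.2 : ℚ_[p])‖ := by
          rw [hpr]
          by_contra hle
          have h2 := (Padic.norm_int_le_pow_iff_dvd (p := p) (ij.2 : ℤ) r).1 (by simpa using hle)
          exact hndvd (by exact_mod_cast h2)
        exact inv_strictAnti₀ (by rw [hpr]; positivity) this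
  rw [IsUltrametricDist.norm_add_eq_max_of_norm_ne_norm hlt.ne', max_eq_left hlt.le]

theorem norm_pScale_le {α : Fin d → ℕ} {n : ℕ} (h : ∀ j, n ≤ α j) (s : Fin d → ℤ_[p]) :
    ‖pScale α s‖ ≤ ((p : ℝ) ^ n)⁻¹ * ‖s‖ := by
  have hp : (1 : ℝ) ≤ p := by exact_mod_cast (Fact.out : p.Prime).one_le
  refine (pi_norm_le_iff_of_nonneg (by positivity)).2 fun j => ?_
  rw [pScale, norm_mul, norm_pow, PadicInt.norm_p, inv_pow]
  gcongr
  · exact h j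
  · exact norm_le_pi_norm s j

theorem Approx.taylor {φ : (Fin d → ℤ_[p]) → ℚ_[p]} {v : (Fin d → ℤ_[p]) → Fin d → ℚ_[p]}
    (hφ : Approx (fun t h => φ (t + h)) v) {a : ℚ_[p]} (ha : ‖a‖ ≤ 1)
    {f : (Fin d → ℤ_[p]) → ℤ_[p]} (hf : ∀ t, (f t : ℚ_[p]) = a * φ t)
    {w : Fin d → ℕ} {n₀ : ℕ} {V : (Fin d → ℤ_[p]) → Fin d → ℤ_[p]}
    (hV : ∀ t j, (V t j : ℚ_[p]) * (p : ℚ_[p]) ^ n₀ = a * v t j * (p : ℚ_[p]) ^ w j) (M : ℕ) :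
    ∃ N, ∀ n ≥ N, ∀ t, ∃ e : (Fin d → ℤ_[p]) → ℤ_[p], LipschitzWith 1 e ∧ ∀ s,
      f (t + pScale (fun j => n + w j) s) = f t + (p : ℤ_[p]) ^ (n + n₀) *
        (∑ j, V t j * s j + (p : ℤ_[p]) ^ (M + 1) * e s) := by
  obtain ⟨C, hC, -, -, herr⟩ := hφ
  have hp1 : (1 : ℝ) < p := by exact_mod_cast (Fact.out : p.Prime).one_lt
  have hp0 : (p : ℚ_[p]) ≠ 0 := by exact_mod_cast (Fact.out : p.Prime).ne_zero
  obtain ⟨N, hN⟩ := pow_unbounded_of_one_lt (C * (p : ℝ) ^ (n₀ + (M + 1))) hp1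
  refine ⟨N, fun n hn t => ?_⟩
  let h : (Fin d → ℤ_[p]) → Fin d → ℤ_[p] := pScale fun j => n + w j
  let q : ℚ_[p] := (p : ℚ_[p]) ^ (n + n₀ + (M + 1))
  have hq : q ≠ 0 := pow_ne_zero _ hp0
  let ρ : (Fin d → ℤ_[p]) → ℚ_[p] := fun s =>
    a * (φ (t + h s) - φ t - ∑ j, v t j * (h s j : ℚ_[p])) / q
  have hρ : ∀ s s', ‖ρ s - ρ s'‖ ≤ ‖s - s'‖ := by
    intro s s'
    have hid : ρ s - ρ s' = a * (φ (t + h s) - φ (t + h s') -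
        ∑ j, v t j * ((h s j : ℚ_[p]) - h s' j)) / q := by
      simp only [ρ, mul_sub, Finset.sum_sub_distrib]
      ring
    have hsub : h s - h s' = h (s - s') := by
      ext j; simp [h, pScale, mul_sub]
    have hle : ∀ s : Fin d → ℤ_[p], ‖h s‖ ≤ ((p : ℝ) ^ n)⁻¹ * ‖s‖ := norm_pScale_le fun j => by omega
    have hle' : ∀ s : Fin d → ℤ_[p], ‖h s‖ ≤ ((p : ℝ) ^ n)⁻¹ := fun s =>
      (hle s).trans (mul_le_of_le_one_right (by positivity) (norm_padicInt_vec_le_one s))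
    have hnq : ‖q‖ = ((p : ℝ) ^ (n + n₀ + (M + 1)))⁻¹ := by
      simp only [q, norm_pow, Padic.norm_p, inv_pow]
    have hNn : C * (p : ℝ) ^ (n₀ + (M + 1)) ≤ (p : ℝ) ^ n :=
      hN.le.trans (pow_le_pow_right₀ hp1.le hn)
    rw [hid, norm_div, norm_mul, hnq, div_inv_eq_mul]
    have hpn : (0 : ℝ) < (p : ℝ) ^ n := by positivity
    calc ‖a‖ * ‖φ (t + h s) - φ (t + h s') - ∑ j, v t j * ((h s j : ℚ_[p]) - h s' j)‖ *
          (p : ℝ) ^ (n + n₀ + (M + 1))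
        ≤ 1 * (C * ((p : ℝ) ^ n)⁻¹ * (((p : ℝ) ^ n)⁻¹ * ‖s - s'‖)) *
          (p : ℝ) ^ (n + n₀ + (M + 1)) := by
          gcongr
          refine (herr t (h s) (h s')).trans ?_
          gcongr
          · exact max_le (hle' s) (hle' s')
          · rw [hsub]
            exact hle _
      _ = (C * (p : ℝ) ^ (n₀ + (M + 1))) * ((p : ℝ) ^ n)⁻¹ * ‖s - s'‖ := by
          rw [add_assoc n, pow_add _ n]
          field_simp
      _ ≤ 1 * ‖s - s'‖ := by
          gcongr
          rw [← div_eq_mul_inv]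
          exact div_le_one_of_le₀ hNn hpn.le
      _ = ‖s - s'‖ := one_mul _
  have hρ0 : ρ 0 = 0 := by
    have : h 0 = 0 := by ext j; simp [h, pScale]
    simp [ρ, this]
  have hρ1 : ∀ s, ‖ρ s‖ ≤ 1 := fun s => by
    have := hρ s 0
    rw [hρ0, sub_zero, sub_zero] at this
    exact this.trans (norm_padicInt_vec_le_one s)
  choose e he using fun s => exists_padicInt_eq (hρ1 s)
  refine ⟨e, LipschitzWith.of_dist_le_mul fun s s' => ?_, fun s => PadicInt.ext ?_⟩
  · rw [NNReal.coe_one, one_mul, dist_eq_norm, dist_eq_norm, PadicInt.norm_def, PadicInt.coe_sub,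
      he, he]
    exact hρ s s'
  · have hsum : (p : ℚ_[p]) ^ (n + n₀) * ∑ j, (V t j : ℚ_[p]) * s j =
        a * ∑ j, v t j * (h s j : ℚ_[p]) := by
      rw [Finset.mul_sum, Finset.mul_sum]
      refine Finset.sum_congr rfl fun j _ => ?_
      simp only [h, pScale, PadicInt.coe_mul, PadicInt.coe_pow, PadicInt.coe_natCast, pow_add]
      linear_combination (p : ℚ_[p]) ^ n * s j * hV t j
    have hq' : q * ρ s = a * (φ (t + h s) - φ t - ∑ j, v t j * (h s j : ℚ_[p])) :=
      mul_div_cancel₀ _ hq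
    simp only [PadicInt.coe_add, PadicInt.coe_mul, PadicInt.coe_pow, PadicInt.coe_natCast,
      PadicInt.coe_sum]
    rw [he, hf, hf, mul_add, hsum, ← mul_assoc, ← pow_add]
    change a * φ (t + h s) = a * φ t + (_ + q * ρ s)
    rw [hq']
    ring

end Taylor

section Coefficients

variable {p : ℕ} [Fact p.Prime] {d : ℕ}

theorem norm_natCast_eq_pow_padicValNat {h : ℕ} (hh : h ≠ 0) :
    ‖(h : ℚ_[p])‖ = ‖((p ^ padicValNat p h : ℕ) : ℚ_[p])‖ := by
  rw [Padic.norm_eq_zpow_neg_valuation (by exact_mod_cast hh), Padic.valuation_natCast,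
    Nat.cast_pow, Padic.norm_p_pow]

/-- For coefficients decreasing in absolute value, the supremum of `|a_{h e_j} / h|` is attained
at a power of `p`. -/
theorem exists_prime_pow_maximizer {a : (Fin d → ℕ) →₀ ℚ_[p]} (ha1 : ∀ j, a (Pi.single j 1) ≠ 0)
    (hmono : ∀ k l : Fin d → ℕ, k ≤ l → ‖a l‖ ≤ ‖a k‖) (j : Fin d) :
    ∃ r : ℕ, a (Pi.single j (p ^ r)) ≠ 0 ∧ ∀ h : ℕ, 1 ≤ h →
      ‖a (Pi.single j h) / (h : ℚ_[p])‖ ≤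
        ‖a (Pi.single j (p ^ r)) / ((p ^ r : ℕ) : ℚ_[p])‖ := by
  let S : Finset ℕ := a.support.preimage (fun h => Pi.single j h)
    ((Pi.single_injective (M := fun _ : Fin d => ℕ) j).injOn)
  have h1S : 1 ∈ S := by simpa [S] using ha1 j
  obtain ⟨h₀, hh₀, hmax⟩ := S.exists_max_image
    (fun h => ‖a (Pi.single j h) / (h : ℚ_[p])‖) ⟨1, h1S⟩
  have hpos : h₀ ≠ 0 := by
    rintro rfl
    have := hmax 1 h1S
    simp only [Nat.cast_zero, div_zero, norm_zero, Nat.cast_one, div_one, norm_le_zero_iff] at this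
    exact ha1 j this
  have ha₀ : a (Pi.single j h₀) ≠ 0 := by simpa [S] using hh₀
  have hle : p ^ padicValNat p h₀ ≤ h₀ := Nat.le_of_dvd (Nat.pos_of_ne_zero hpos) pow_padicValNat_dvd
  have hale := hmono (Pi.single j (p ^ padicValNat p h₀)) (Pi.single j h₀)
    (Pi.single_mono (f := fun _ : Fin d => ℕ) j hle)
  refine ⟨padicValNat p h₀, ?_, fun h _ => ?_⟩
  · exact norm_pos_iff.1 ((norm_pos_iff.2 ha₀).trans_le hale)
  · have hstep : ‖a (Pi.single j h₀) / (h₀ : ℚ_[p])‖ ≤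
        ‖a (Pi.single j (p ^ padicValNat p h₀)) / ((p ^ padicValNat p h₀ : ℕ) : ℚ_[p])‖ := by
      rw [norm_div, norm_div, norm_natCast_eq_pow_padicValNat hpos]
      gcongr
    by_cases hh : h ∈ S
    · exact (hmax h hh).trans hstep
    · have : a (Pi.single j h) = 0 := by simpa [S] using hh
      rw [this, zero_div, norm_zero]
      exact norm_nonneg _

theorem exists_norm_eq_pow_div {c : Fin d → ℚ_[p]} (hc : ∀ j, c j ≠ 0) :
    ∃ (n₀ : ℕ) (w : Fin d → ℕ), ∀ j, (p : ℝ) ^ n₀ * ‖c j‖ = (p : ℝ) ^ w j := by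
  have hp0 : (p : ℝ) ≠ 0 := by exact_mod_cast (Fact.out : p.Prime).ne_zero
  refine ⟨∑ j, (c j).valuation.natAbs, fun j =>
    ((∑ j, (c j).valuation.natAbs : ℕ) - (c j).valuation).toNat, fun j => ?_⟩
  have hle : (c j).valuation.natAbs ≤ ∑ j, (c j).valuation.natAbs :=
    Finset.single_le_sum (f := fun j => (c j).valuation.natAbs) (fun _ _ => Nat.zero_le _)
      (Finset.mem_univ j)
  rw [Padic.norm_eq_zpow_neg_valuation (hc j), ← zpow_natCast, ← zpow_natCast, ← zpow_add₀ hp0,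
    Int.toNat_of_nonneg (by omega), sub_eq_add_neg]

theorem pow_mul_enorm_eq {c : ℚ_[p]} {n w : ℕ} (h : (p : ℝ) ^ n * ‖c‖ = (p : ℝ) ^ w) :
    (p : ℝ≥0∞) ^ n * ‖c‖ₑ = (p : ℝ≥0∞) ^ w := by
  have hpow : ∀ m : ℕ, (p : ℝ≥0∞) ^ m = ENNReal.ofReal ((p : ℝ) ^ m) := fun m => by
    rw [ENNReal.ofReal_pow (Nat.cast_nonneg p), ENNReal.ofReal_natCast]
  rw [← ofReal_norm, hpow, hpow, ← ENNReal.ofReal_mul (by positivity), h]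

theorem iSup_enorm_eq {a : (Fin d → ℕ) →₀ ℚ_[p]} {j : Fin d} {r : ℕ}
    (h : ∀ h : ℕ, 1 ≤ h → ‖a (Pi.single j h) / (h : ℚ_[p])‖ ≤
        ‖a (Pi.single j (p ^ r)) / ((p ^ r : ℕ) : ℚ_[p])‖) :
    ⨆ h : ℕ+, ‖a (Pi.single j (h : ℕ)) / ((h : ℕ) : ℚ_[p])‖ₑ =
      ‖a (Pi.single j (p ^ r)) / ((p ^ r : ℕ) : ℚ_[p])‖ₑ := by
  refine le_antisymm (iSup_le fun k => ?_) ?_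
  · rw [← ofReal_norm, ← ofReal_norm]
    exact ENNReal.ofReal_le_ofReal (h k k.2)
  · exact le_iSup (fun k : ℕ+ => ‖a (Pi.single j (k : ℕ)) / ((k : ℕ) : ℚ_[p])‖ₑ)
      ⟨p ^ r, pow_pos (Fact.out : p.Prime).pos r⟩

theorem exists_single_combination {κ : Type*} [Fintype κ] [DecidableEq κ] {k₀ : κ} {κs : Fin d → κ}
    {φ : κ → ℤ_[p]} {V : κ → Fin d → ℤ_[p]} (hφ : φ k₀ = 1) (hV0 : ∀ j, V k₀ j = 0)
    (hVu : ∀ j, IsUnit (V (κs j) j)) (hVo : ∀ i j, i ≠ j → V (κs i) j = 0)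
    (y : ℤ_[p]) (u : Fin d → ℤ_[p]) :
    ∃ ζ : κ → ℤ_[p], ∑ k, ζ k * φ k = y ∧ ∀ j, ∑ k, ζ k * V k j = u j := by
  choose b hb using fun j => (hVu j).exists_left_inv
  let c : Fin d → ℤ_[p] := fun j => u j * b j
  have key : ∀ (A : ℤ_[p]) (g : κ → ℤ_[p]),
      ∑ k, ((Pi.single k₀ A : κ → ℤ_[p]) k + ∑ i, (Pi.single (κs i) (c i) : κ → ℤ_[p]) k) * g k =
        A * g k₀ + ∑ i, c i * g (κs i) := by
    intro A g
    simp only [add_mul, Finset.sum_add_distrib, Finset.sum_mul]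
    rw [Finset.sum_comm (s := Finset.univ (α := κ))]
    simp [Pi.single_apply]
  refine ⟨fun k => (Pi.single k₀ (y - ∑ i, c i * φ (κs i)) : κ → ℤ_[p]) k +
    ∑ i, (Pi.single (κs i) (c i) : κ → ℤ_[p]) k, ?_, fun j => ?_⟩
  · rw [key, hφ]
    ring
  · rw [key _ fun k => V k j, hV0, mul_zero, zero_add, Finset.sum_eq_single j]
    · rw [mul_assoc, hb, mul_one]
    · intro i _ hij
      rw [hVo i j hij, mul_zero]
    · simp

/-- The expected number of solutions of the random system in the functions
`a_k binom(t_1, k_1) ⋯ binom(t_d, k_d)` with uniformly distributed coefficients in `ℤ_p`. -/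
theorem lintegral_binomial_system {a : (Fin d → ℕ) →₀ ℚ_[p]} (ha0 : a 0 = 1)
    (ha1 : ∀ j, a (Pi.single j 1) ≠ 0)
    (hmono : ∀ k l : Fin d → ℕ, k ≤ l → ‖a l‖ ≤ ‖a k‖)
    {f : a.support → (Fin d → ℤ_[p]) → ℤ_[p]} (hfc : ∀ k, Continuous (f k))
    (hf : ∀ k t, (f k t : ℚ_[p]) = a k.1 * ∏ j, ((Ring.choose (t j) (k.1 j) : ℤ_[p]) : ℚ_[p]))
    (x : Fin d → ℤ_[p]) :
    ∫⁻ z : Fin d × a.support → ℤ_[p],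
        ((({t | sysVal f z t = x} : Set (Fin d → ℤ_[p])).encard : ℕ∞) : ℝ≥0∞) =
      (∏ j : Fin d, ⨆ h : ℕ+, ‖a (Pi.single j (h : ℕ)) / ((h : ℕ) : ℚ_[p])‖ₑ) *
        (∑ i ∈ Finset.range (d + 1), (p : ℝ≥0∞)⁻¹ ^ i)⁻¹ := by
  classical
  choose r hr0 hrmax using exists_prime_pow_maximizer ha1 hmono
  let c : Fin d → ℚ_[p] := fun j => a (Pi.single j (p ^ r j)) / ((p ^ r j : ℕ) : ℚ_[p])
  have hp0 : (p : ℚ_[p]) ≠ 0 := by exact_mod_cast (Fact.out : p.Prime).ne_zero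
  have hpR : (0 : ℝ) < p := by exact_mod_cast (Fact.out : p.Prime).pos
  have hc0 : ∀ j, c j ≠ 0 := fun j => div_ne_zero (hr0 j) (by push_cast; exact pow_ne_zero _ hp0)
  obtain ⟨n₀, w, hw⟩ := exists_norm_eq_pow_div hc0
  have hale : ∀ k, ‖a k‖ ≤ 1 := fun k => by
    simpa [ha0] using hmono 0 k (fun _ => Nat.zero_le _)
  let D : (Fin d → ℕ) → (Fin d → ℤ_[p]) → Fin d → ℚ_[p] := fun k t j =>
    (∏ i ∈ Finset.univ.erase j, ((Ring.choose (t i) (k i) : ℤ_[p]) : ℚ_[p])) *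
      chooseDeriv (k j) (t j)
  have hprod : ∀ (S : Finset (Fin d)) (t : Fin d → ℤ_[p]) (k : Fin d → ℕ),
      ‖∏ i ∈ S, ((Ring.choose (t i) (k i) : ℤ_[p]) : ℚ_[p])‖ ≤ 1 := by
    intro S t k
    rw [norm_prod]
    exact Finset.prod_le_one (fun _ _ => norm_nonneg _) fun _ _ => norm_coe_le_one _
  have hscale : ∀ j (y : ℚ_[p]), ‖y * (p : ℚ_[p]) ^ w j / (p : ℚ_[p]) ^ n₀‖ = ‖y‖ / ‖c j‖ := by
    intro j y
    have hcj := norm_pos_iff.2 (hc0 j)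
    rw [norm_div, norm_mul, norm_pow, norm_pow, Padic.norm_p, inv_pow, inv_pow, ← hw j]
    field_simp
  have hVex : ∀ (k : a.support) (t : Fin d → ℤ_[p]) (j : Fin d), ∃ v : ℤ_[p],
      (v : ℚ_[p]) = a k.1 * D k.1 t j * (p : ℚ_[p]) ^ w j / (p : ℚ_[p]) ^ n₀ := by
    intro k t j
    refine exists_padicInt_eq ?_
    rw [hscale]
    refine div_le_one_of_le₀ ?_ (norm_nonneg _)
    rw [mul_left_comm, norm_mul]
    refine (mul_le_of_le_one_left (norm_nonneg _) (hprod _ _ _)).trans ?_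
    refine norm_mul_chooseDeriv_le (norm_nonneg _) (fun i hi hik => ?_) (t j)
    refine le_trans ?_ (hrmax j i hi)
    rw [norm_div, norm_div]
    gcongr
    refine hmono _ _ fun j' => ?_
    rcases eq_or_ne j' j with rfl | hne
    · simpa using hik
    · simp [hne]
  choose V hV using hVex
  have hmem0 : (0 : Fin d → ℕ) ∈ a.support := by simp [ha0]
  have hmems : ∀ j, (Pi.single j (p ^ r j) : Fin d → ℕ) ∈ a.support := fun j => by
    simpa using hr0 j
  have hderiv0 : ∀ t : ℤ_[p], chooseDeriv 0 t = 0 := fun t => by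
    simp [chooseDeriv, chooseDerivZero]
  have hVzero : ∀ (k : a.support) t j, k.1 j = 0 → V k t j = 0 := by
    intro k t j hk
    refine PadicInt.ext ?_
    rw [hV]
    simp [D, hk, hderiv0]
  have hVunit : ∀ t j, IsUnit (V ⟨_, hmems j⟩ t j) := by
    intro t j
    have hD : D (Pi.single j (p ^ r j)) t j = chooseDeriv (p ^ r j) (t j) := by
      simp only [D, Pi.single_eq_same]
      rw [Finset.prod_eq_one, one_mul]
      intro i hi
      rw [Pi.single_eq_of_ne (Finset.ne_of_mem_erase hi), Ring.choose_zero_right, PadicInt.coe_one]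
    rw [PadicInt.isUnit_iff, PadicInt.norm_def, hV, hscale, hD, norm_mul,
      norm_chooseDeriv_prime_pow, ← norm_mul, ← div_eq_mul_inv]
    exact div_self (norm_ne_zero_iff.2 (hc0 j))
  have hsurj : ∀ t (y : ℤ_[p]) (u : Fin d → ℤ_[p]), ∃ ζ : a.support → ℤ_[p],
      ∑ k, ζ k * f k t = y ∧ ∀ j, ∑ k, ζ k * V k t j = u j := by
    intro t
    refine exists_single_combination (k₀ := ⟨0, hmem0⟩) (κs := fun j => ⟨_, hmems j⟩) ?_
      (fun j => hVzero _ t j rfl) (hVunit t) fun i j hij => hVzero _ t j ?_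
    · refine PadicInt.ext ?_
      rw [hf]
      simp [ha0]
    · exact Pi.single_eq_of_ne hij.symm _
  have htaylor : ∀ M, ∃ N, ∀ n ≥ N, ∀ t k, ∃ e : (Fin d → ℤ_[p]) → ℤ_[p],
      LipschitzWith 1 e ∧ ∀ s,
      f k (t + pScale (fun j => n + w j) s) = f k t + (p : ℤ_[p]) ^ (n + n₀) *
        (∑ j, V k t j * s j + (p : ℤ_[p]) ^ (M + 1) * e s) := by
    intro M
    have hk : ∀ k : a.support, ∃ N, ∀ n ≥ N, ∀ t, ∃ e : (Fin d → ℤ_[p]) → ℤ_[p],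
        LipschitzWith 1 e ∧ ∀ s,
        f k (t + pScale (fun j => n + w j) s) = f k t + (p : ℤ_[p]) ^ (n + n₀) *
          (∑ j, V k t j * s j + (p : ℤ_[p]) ^ (M + 1) * e s) := by
      intro k
      have hA := approx_prod_choose (p := p) k.1 Finset.univ
      simp only [Finset.mem_univ, if_true] at hA
      refine Approx.taylor (φ := fun t => ∏ j, ((Ring.choose (t j) (k.1 j) : ℤ_[p]) : ℚ_[p]))
        (v := D k.1) hA (hale k.1) (hf k) (fun t j => ?_) M
      rw [hV, div_mul_cancel₀ _ (pow_ne_zero _ hp0)]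
    choose N hN using hk
    refine ⟨Finset.univ.sup N, fun n hn t k => hN k n ?_ t⟩
    exact (Finset.le_sup (Finset.mem_univ k)).trans hn
  have hmain := lintegral_encard_solutions f V hfc w n₀ htaylor hsurj x
  rw [volume_lat_zero] at hmain
  have hprodc : (p : ℝ≥0∞) ^ (n₀ * d) * ∏ j, ‖c j‖ₑ = (p : ℝ≥0∞) ^ (∑ j, w j) := by
    rw [← Finset.prod_pow_eq_pow_sum, ← Finset.prod_congr rfl fun j _ => pow_mul_enorm_eq (hw j),
      Finset.prod_mul_distrib]
    simp [pow_mul]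
  simp only [fun j => iSup_enorm_eq (hrmax j)]
  rw [← hprodc, mul_assoc] at hmain
  have hp0' : (p : ℝ≥0∞) ^ (n₀ * d) ≠ 0 :=
    pow_ne_zero _ (by simpa using (Fact.out : p.Prime).ne_zero)
  exact (ENNReal.mul_right_inj hp0' (ENNReal.pow_ne_top (ENNReal.natCast_ne_top p))).1 hmain

end Coefficients

section Transfer

variable {p : ℕ} [Fact p.Prime] {d : ℕ}

/-- The inclusion of `ℤ_p` in `ℚ_p`. -/
noncomputable def inclusion (p : ℕ) [Fact p.Prime] : ℤ_[p] →+ ℚ_[p] :=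
  (PadicInt.Coe.ringHom (p := p)).toAddMonoidHom

theorem inclusion_apply (x : ℤ_[p]) : inclusion p x = x := rfl

theorem isOpenEmbedding_inclusion : Topology.IsOpenEmbedding (inclusion p) :=
  PadicInt.isOpenEmbedding_coe

theorem padicGaussian_eq_map :
    padicGaussian p = (volume : Measure ℤ_[p]).map (inclusion p) := by
  have hemb := isOpenEmbedding_inclusion (p := p)
  have hrange : Set.range (inclusion p) = Metric.closedBall 0 1 := by
    ext y
    rw [mem_closedBall_zero_iff]
    exact ⟨by rintro ⟨c, rfl⟩; exact norm_coe_le_one c, fun h => exists_padicInt_eq h⟩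
  have : (padicHaar p).IsAddHaarMeasure :=
    inferInstanceAs (Measure.addHaarMeasure (unitBall p)).IsAddHaarMeasure
  have hH : ((padicHaar p).comap (inclusion p)).IsAddHaarMeasure :=
    Measure.IsAddHaarMeasure.comap (mH := inferInstance) (padicHaar p) hemb
  have hP : IsProbabilityMeasure ((padicHaar p).comap (inclusion p)) := by
    refine ⟨?_⟩
    rw [hemb.measurableEmbedding.comap_apply, Set.image_univ, hrange]
    exact Measure.addHaarMeasure_self (K₀ := unitBall p)
  rw [Measure.isAddHaarMeasure_eq_of_isProbabilityMeasure volume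
    ((padicHaar p).comap (inclusion p)), hemb.measurableEmbedding.map_comap, hrange]
  rfl

theorem continuous_choose_prod (k : Fin d → ℕ) :
    Continuous fun t : Fin d → ℤ_[p] => ∏ j, Ring.choose (t j) (k j) :=
  continuous_finsetProd _ fun j _ =>
    (PadicInt.continuous_choose (k j)).comp (continuous_apply j)

/-- The number of solutions as a function of the finitely many relevant coefficients. -/
theorem numSolutions_eq (a : (Fin d → ℕ) →₀ ℚ_[p]) (z : Fin d → (Fin d → ℕ) → ℚ_[p])
    (x : Fin d → ℤ_[p]) :
    numSolutions a z x = (({t : Fin d → ℤ_[p] | ((fun ik : Fin d × a.support => z ik.1 ik.2.1), t) ∈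
      {q : (Fin d × a.support → ℚ_[p]) × (Fin d → ℤ_[p]) | ∀ i, ∑ k : a.support, a k.1 * q.1 (i, k) *
        ((∏ j, Ring.choose (q.2 j) (k.1 j) : ℤ_[p]) : ℚ_[p]) = x i}}.encard : ℕ∞) : ℝ≥0∞) := by
  have hprod : ∀ (t : Fin d → ℤ_[p]) (k : Fin d → ℕ),
      ((∏ j, Ring.choose (t j) (k j) : ℤ_[p]) : ℚ_[p]) =
        ∏ j, ((Ring.choose (t j) (k j) : ℤ_[p]) : ℚ_[p]) := fun t k =>
    map_prod PadicInt.Coe.ringHom _ _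
  unfold numSolutions
  congr 3
  ext t
  simp only [F, Finsupp.sum, Set.mem_ofPred_eq, hprod]
  refine forall_congr' fun i => ?_
  rw [← Finset.sum_coe_sort]

theorem isClosed_solutions (a : (Fin d → ℕ) →₀ ℚ_[p]) (x : Fin d → ℤ_[p]) :
    IsClosed {q : (Fin d × a.support → ℚ_[p]) × (Fin d → ℤ_[p]) | ∀ i,
      ∑ k : a.support, a k.1 * q.1 (i, k) *
        ((∏ j, Ring.choose (q.2 j) (k.1 j) : ℤ_[p]) : ℚ_[p]) = x i} := by
  simp only [Set.ofPred_forall]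
  refine isClosed_iInter fun i => isClosed_eq (continuous_finsetSum _ fun k _ => ?_)
    continuous_const
  refine Continuous.mul (by fun_prop) ?_
  exact PadicInt.isOpenEmbedding_coe.continuous.comp
    ((continuous_choose_prod k.1).comp continuous_snd)

theorem expected_numSolutions {Ω : Type*} [MeasurableSpace Ω] {P : Measure Ω}
    [IsProbabilityMeasure P] {Z : Fin d → (Fin d → ℕ) → Ω → ℚ_[p]}
    (hZ_meas : ∀ i k, Measurable (Z i k))
    (hZ_law : ∀ i k, P.map (Z i k) = padicGaussian p)
    (hZ_indep : iIndepFun (fun ik : Fin d × (Fin d → ℕ) => Z ik.1 ik.2) P)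
    {a : (Fin d → ℕ) →₀ ℚ_[p]} (ha0 : a 0 = 1) (ha1 : ∀ j, a (Pi.single j 1) ≠ 0)
    (hmono : ∀ k l : Fin d → ℕ, k ≤ l → ‖a l‖ ≤ ‖a k‖) (x : Fin d → ℤ_[p]) :
    Measurable (fun ω => numSolutions a (fun i k => Z i k ω) x) ∧
      ∫⁻ ω, numSolutions a (fun i k => Z i k ω) x ∂P =
        (∏ j : Fin d, ⨆ h : ℕ+, ‖a (Pi.single j (h : ℕ)) / ((h : ℕ) : ℚ_[p])‖ₑ) *
          (∑ i ∈ Finset.range (d + 1), (p : ℝ≥0∞)⁻¹ ^ i)⁻¹ := by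
  have hZm : Measurable fun ω => fun ik : Fin d × a.support => Z ik.1 ik.2.1 ω :=
    measurable_pi_lambda _ fun ik => hZ_meas _ _
  have hcount := measurable_encard_fiber (isClosed_solutions a x)
  simp only [numSolutions_eq]
  refine ⟨hcount.comp hZm, ?_⟩
  have hinj : Function.Injective fun ik : Fin d × a.support => (ik.1, ik.2.1) := by
    rintro ⟨i, k⟩ ⟨i', k'⟩ h
    simp only [Prod.mk.injEq] at h
    exact Prod.ext h.1 (Subtype.ext h.2)
  have hlaw := (hZ_indep.precomp hinj).map_fun_eq_pi_map fun ik => (hZ_meas _ _).aemeasurable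
  simp only [hZ_law, padicGaussian_eq_map] at hlaw
  have hcoe : Measurable (inclusion p) := isOpenEmbedding_inclusion.continuous.measurable
  rw [← Measure.pi_map_pi fun _ => hcoe.aemeasurable] at hlaw
  have hcoe' : Measurable fun (z : Fin d × a.support → ℤ_[p]) ik => inclusion p (z ik) :=
    measurable_pi_lambda _ fun ik => hcoe.comp (measurable_pi_apply ik)
  rw [← lintegral_map hcount hZm, hlaw, lintegral_map hcount hcoe']
  have hale : ∀ k, ‖a k‖ ≤ 1 := fun k => by
    simpa [ha0] using hmono 0 k (fun _ => Nat.zero_le _)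
  choose b hb using fun k => exists_padicInt_eq (hale k)
  let f : a.support → (Fin d → ℤ_[p]) → ℤ_[p] := fun k t =>
    b k.1 * ∏ j, Ring.choose (t j) (k.1 j)
  have hcastprod : ∀ (t : Fin d → ℤ_[p]) (k : Fin d → ℕ),
      ((∏ j, Ring.choose (t j) (k j) : ℤ_[p]) : ℚ_[p]) =
        ∏ j, ((Ring.choose (t j) (k j) : ℤ_[p]) : ℚ_[p]) := fun t k =>
    map_prod PadicInt.Coe.ringHom _ _
  rw [← lintegral_binomial_system ha0 ha1 hmono (f := f)
    (fun k => continuous_const.mul (continuous_choose_prod k.1))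
    (fun k t => by simp only [f, PadicInt.coe_mul, hb, hcastprod]) x]
  rw [volume_pi]
  refine lintegral_congr fun z => ?_
  congr 3
  ext t
  simp only [Set.mem_ofPred_eq, sysVal, funext_iff, inclusion_apply]
  refine forall_congr' fun i => ?_
  have hcoef : ∀ k : a.support, ((z (i, k) * f k t : ℤ_[p]) : ℚ_[p]) = a k.1 * z (i, k) *
      ((∏ j, Ring.choose (t j) (k.1 j) : ℤ_[p]) : ℚ_[p]) := fun k => by
    simp only [f, PadicInt.coe_mul, hb]
    ring
  simp only [← hcoef, ← PadicInt.coe_sum]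
  exact ⟨fun h => PadicInt.ext h, fun h => congrArg _ h⟩

end Transfer

section SimplestModel

variable {p : ℕ} [Fact p.Prime] {d : ℕ}

theorem simplestModel_apply (N : ℕ) (k : Fin d → ℕ) :
    simplestModel p d N k = if ∀ j, k j ≤ N then 1 else 0 := by
  classical
  simp [simplestModel, Finsupp.indicator_apply, Pi.le_def]

theorem simplestModel_single {N : ℕ} (j : Fin d) (h : ℕ) :
    simplestModel p d N (Pi.single j h) = if h ≤ N then 1 else 0 := by
  rw [simplestModel_apply]
  congr 1
  refine propext ⟨fun H => by simpa using H j, fun H j' => ?_⟩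
  rcases eq_or_ne j' j with rfl | hne
  · simpa using H
  · simp [hne]

theorem iSup_simplestModel {N : ℕ} (hN : 1 ≤ N) (j : Fin d) :
    ⨆ h : ℕ+, ‖simplestModel p d N (Pi.single j (h : ℕ)) / ((h : ℕ) : ℚ_[p])‖ₑ =
      (p : ℝ≥0∞) ^ Nat.log p N := by
  have hp1 := (Fact.out : p.Prime).one_lt
  have hpR : (1 : ℝ) < p := by exact_mod_cast hp1
  have hpow : p ^ Nat.log p N ≤ N := Nat.pow_log_le_self p (by omega)
  have hval : ∀ r : ℕ, ‖((p ^ r : ℕ) : ℚ_[p])‖ = ((p : ℝ) ^ r)⁻¹ := fun r => by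
    push_cast
    rw [norm_pow, Padic.norm_p, inv_pow]
  rw [iSup_enorm_eq (r := Nat.log p N)]
  · have := pow_mul_enorm_eq (p := p) (n := 0) (w := Nat.log p N)
      (c := simplestModel p d N (Pi.single j (p ^ Nat.log p N)) / ((p ^ Nat.log p N : ℕ) : ℚ_[p]))
      (by rw [simplestModel_single, if_pos hpow, norm_div, hval]; simp)
    simpa using this
  · intro h hh
    rw [simplestModel_single, simplestModel_single, if_pos hpow, norm_div, norm_div, hval]
    split_ifs with hhN
    · rw [norm_natCast_eq_pow_padicValNat (by omega), hval]
      have hle : padicValNat p h ≤ Nat.log p N :=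
        (padicValNat_le_nat_log h).trans (Nat.log_mono_right hhN)
      simp only [norm_one, one_div, inv_inv]
      exact pow_le_pow_right₀ hpR.le hle
    · simp only [norm_zero, zero_div]
      positivity

theorem simplestModel_antitone (N : ℕ) (k l : Fin d → ℕ) (h : k ≤ l) :
    ‖simplestModel p d N l‖ ≤ ‖simplestModel p d N k‖ := by
  rw [simplestModel_apply, simplestModel_apply]
  split_ifs with h1 h2
  · exact le_rfl
  · exact absurd (fun j => (h j).trans (h1 j)) h2
  · simp
  · exact le_rfl

end SimplestModel

end PadicSystem

theorem theorem1 (p : ℕ) [Fact p.Prime] (d : ℕ)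
    {Ω : Type*} [MeasurableSpace Ω] (P : Measure Ω) [IsProbabilityMeasure P]
    (Z : Fin d → (Fin d → ℕ) → Ω → ℚ_[p])
    (hZ_meas : ∀ i k, Measurable (Z i k))
    (hZ_law : ∀ i k, P.map (Z i k) = PadicSystem.padicGaussian p)
    (hZ_indep : iIndepFun (fun ik : Fin d × (Fin d → ℕ) => Z ik.1 ik.2) P) :
    (∀ a : (Fin d → ℕ) →₀ ℚ_[p],
      a 0 = 1 →
      (∀ j, a (Pi.single j 1) ≠ 0) →
      (∀ k l : Fin d → ℕ, k ≤ l → ‖a l‖ ≤ ‖a k‖) →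
      ∀ x : Fin d → ℤ_[p],
        Measurable (fun ω => PadicSystem.numSolutions a (fun i k => Z i k ω) x) ∧
        ∫⁻ ω, PadicSystem.numSolutions a (fun i k => Z i k ω) x ∂P =
          (∏ j : Fin d, ⨆ h : ℕ+, ‖a (Pi.single j (h : ℕ)) / ((h : ℕ) : ℚ_[p])‖ₑ) *
            (∑ i ∈ Finset.range (d + 1), (p : ℝ≥0∞)⁻¹ ^ i)⁻¹) ∧
    (∀ N : ℕ, 1 ≤ N → ∀ x : Fin d → ℤ_[p],
        Measurable (fun ω => PadicSystem.numSolutions (PadicSystem.simplestModel p d N)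
          (fun i k => Z i k ω) x) ∧
        ∫⁻ ω, PadicSystem.numSolutions (PadicSystem.simplestModel p d N)
            (fun i k => Z i k ω) x ∂P =
          (p : ℝ≥0∞) ^ (d * Nat.log p N) *
            (∑ i ∈ Finset.range (d + 1), (p : ℝ≥0∞)⁻¹ ^ i)⁻¹) := by
  refine ⟨fun a ha0 ha1 hmono x =>
    PadicSystem.expected_numSolutions hZ_meas hZ_law hZ_indep ha0 ha1 hmono x, fun N hN x => ?_⟩
  have h := PadicSystem.expected_numSolutions hZ_meas hZ_law hZ_indep
    (a := PadicSystem.simplestModel p d N)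
    (by simp [PadicSystem.simplestModel_apply])
    (fun j => by simp [PadicSystem.simplestModel_single, hN])
    (PadicSystem.simplestModel_antitone N) x
  simp only [PadicSystem.iSup_simplestModel hN, Finset.prod_const, Finset.card_univ,
    Fintype.card_fin, ← pow_mul] at h
  rwa [mul_comm d]
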